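/- **Setting.** Let $\Omega\subset\mathbb R^d$ ($d\ge 1$) be a bounded open set (e.g. a bounded Lipschitz domain), $\tau>0$, and let $0<\lambda_1\le\lambda_2\le\dots$ be the Dirichlet eigenvalues of $-\Delta$ in $\Omega$ with an orthonormal basis $(\varphi_n)$ of $L^2(\Omega)$ of corresponding (weak, $H^1_0$) eigenfunctions. For $q\ge 0$ let $\mathbb H_q=\{g\in L^2(\Omega):\sum_n\lambda_n^{2q}|\langle g,\varphi_n\rangle|^2<\infty\}$ and for $p,\varrho>0$ let $S_{\varrho,p}=\{g\in\mathbb H_p:\sum_n\lambda_n^{2p}|\langle g,\varphi_n\rangle|^2\le\varrho^2\}$. Norms and inner products without index are those of $L^2(\Omega)$. Let $\psi\in C([0,\tau])$, and suppose that there are $\tau_0\in[0,\tau)$ and $\kappa_1>0$ with $|\psi|\ge\kappa_1$ on $[\tau_0,\tau]$ such that either $\psi$ does not change sign on $[0,\tau]$, or $\psi$ is differentiable on $[0,\tau]$ except possibly at finitely many points with $|\psi'|\le\kappa_2$ there for some $\kappa_2>0$, and $|\psi(t)|\le\frac{(\tau-\tau_0)^2\kappa_1}{4\tau\tau_0}$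 for all $t\in[0,\tau]$ with $\psi(t)\psi(\tau)\le0$. Put $\mu_n(t)=\int_0^t e^{-\lambda_n(t-s)}(t-s)\psi(s)\,ds$ and $\mu_n=\mu_n(\tau)$. Let $f\in S_{\varrho,p}$ and $h=u(\tau)$, where $u\in C([0,\tau];L^2(\Omega))$ is the weak solution of $$u_{tt}-2\Delta u_t+\Delta^2u=\psi(t)f(x)\ \text{in }\Omega\times(0,\tau),\qquad u=\Delta u=0\ \text{on }\partial\Omega\times(0,\tau),\qquad u(0)=u_t(0)=0 .$$ Let $\delta>0$ and let $h^\delta\in L^2(\Omega)$ satisfy $\|h-h^\delta\|\le\delta$. Let $b\ge2$ and $\xi>1$. For $\alpha>0$ put $\mathbb B_\alpha k=\sum_n\frac{\langle k,\varphi_n\rangle}{1+\alpha\lambda_n^b}\varphi_n$, and let $f_\alpha^\delta\in\mathbb H_{b-2}$ be the source for which the mild solution $v\in C([0,\tau];L^2(\Omega))$, $v(t)=\sum_n(1+\alpha\lambda_n^b)\mu_n(t)\langle f_\alpha^\delta,\varphi_n\rangle\varphi_n$, of the regularized problem $$v_{tt}-2\Delta v_t+\Delta^2v=(I+\alpha(-\Delta)^b)\psi(t)f_\alpha^\delta(x),\qquad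 v=\Delta v=0\ \text{on }\partial\Omega\times(0,\tau),\qquad v(0)=v_t(0)=0,$$ satisfies $v(\tau)=h^\delta$. **Theorem.** For every $\alpha>0$ the source $f_\alpha^\delta$ exists and is unique, and there is a constant $C>0$ with $|\mu_n|\ge C/\lambda_n^2$ for all $n$. For every such $C$ the following holds, with positive constants that depend only on the displayed quantities: $C_{\rm apost}=C_{\rm apost}(C,\xi,p)$, $C_6=C_6(C,\|\psi\|_\infty,\xi,p)$, $C_4=C_4(C,\|\psi\|_\infty,\xi,\lambda_1,p,b)$, $C_5=C_5(C,\|\psi\|_\infty,\xi,\lambda_1,p)$. (i) Let $b\ne2$ and $\xi\delta<\|h^\delta\|$ (which holds in particular if $\delta<1$ and $\xi\delta^\sigma\le\|h^\delta\|$ for some $\sigma\in(0,1)$). Then there is a unique $\alpha_\delta>0$ with $\|\mathbb B_{\alpha_\delta}h^\delta-h^\delta\|=\xi\delta$, and $$\|f-f^\delta_{\alpha_\delta}\|\le\begin{cases}C_6\,\varrho^{\frac2{p+2}}\delta^{\frac p{p+2}},&0<p<b-2,\\ C_{\rm apost}\,\varrho^{\frac2{p+2}}\delta^{\frac p{p+2}}+C_4\,\varrho^{\frac2b}\delta^{\frac{b-2}b},&p\ge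 b-2.\end{cases}$$ (ii) Let $b=2$, $\sigma\in(0,1)$, $\delta\le1$ and $\xi\delta^\sigma<\|h^\delta\|$. Then there is a unique $\alpha_\delta>0$ with $\|\mathbb B_{\alpha_\delta}h^\delta-h^\delta\|=\xi\delta^\sigma$, and $$\|f-f^\delta_{\alpha_\delta}\|\le C_{\rm apost}\,\varrho^{\frac2{p+2}}\delta^{\frac{p\sigma}{p+2}}+C_5\,\varrho\,\delta^{1-\sigma}.$$ -/

import Mathlib

open Set Filter Topology MeasureTheory
open scoped ContDiff

noncomputable section

namespace BiParabolic

/-- The Hilbert space `L²(Ω; F)` for `Ω ⊆ ℝᵈ` with Lebesgue measure. -/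
abbrev L2 {d : ℕ} (Ω : Set (EuclideanSpace ℝ (Fin d))) (F : Type) [NormedAddCommGroup F] :=
  Lp F 2 (volume.restrict Ω)

/-- The graph of the gradient on test functions: all pairs `(θ, ∇θ)` with `θ ∈ C_c^∞(Ω)`. -/
def testGraph {d : ℕ} (Ω : Set (EuclideanSpace ℝ (Fin d))) :
    Set (L2 Ω ℝ × L2 Ω (EuclideanSpace ℝ (Fin d))) :=
  {q | ∃ θ : EuclideanSpace ℝ (Fin d) → ℝ,
      ContDiff ℝ ∞ θ ∧ HasCompactSupport θ ∧ tsupport θ ⊆ Ω ∧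
      q.1 =ᵐ[volume.restrict Ω] θ ∧ q.2 =ᵐ[volume.restrict Ω] gradient θ}

/-- The Sobolev space `H¹₀(Ω)`, the closure of `C_c^∞(Ω)` in the `H¹`-norm, as the set of all
pairs `(w, ∇w)` with `w ∈ H¹₀(Ω)` and `∇w` its weak gradient. -/
def H10 {d : ℕ} (Ω : Set (EuclideanSpace ℝ (Fin d))) :
    Set (L2 Ω ℝ × L2 Ω (EuclideanSpace ℝ (Fin d))) :=
  closure (testGraph Ω)

/-- `w ∈ H¹₀(Ω)` and `Δ w = g ∈ L²(Ω)` weakly: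
`∫ ∇w · ∇v = - ∫ g v` for all `v ∈ H¹₀(Ω)`. -/
def HasDirichletLaplacian {d : ℕ} (Ω : Set (EuclideanSpace ℝ (Fin d))) (w g : L2 Ω ℝ) : Prop :=
  ∃ G : L2 Ω (EuclideanSpace ℝ (Fin d)), (w, G) ∈ H10 Ω ∧
    ∀ v : L2 Ω ℝ, ∀ V : L2 Ω (EuclideanSpace ℝ (Fin d)), (v, V) ∈ H10 Ω →
      inner ℝ G V = -inner ℝ g v

/-- `(lam n)` and the orthonormal basis `(φ n)` of `L²(Ω)` are the eigenvalues, in nondecreasing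
order, and the eigenfunctions of `-Δ` in `Ω` with zero boundary values.
The index starts at `0`, so that `lam 0` is the smallest eigenvalue. -/
def IsDirichletEigenbasis {d : ℕ} (Ω : Set (EuclideanSpace ℝ (Fin d))) (lam : ℕ → ℝ)
    (φ : HilbertBasis ℕ ℝ (L2 Ω ℝ)) : Prop :=
  Monotone lam ∧ ∀ n, HasDirichletLaplacian Ω (φ n) (-(lam n • φ n))

/-- `u ∈ C([0,τ]; L²(Ω))` is a weak solution of
`u_tt - 2 Δ u_t + Δ² u = ψ(t) f(x)` in `Ω × (0,τ)`, `u = Δ u = 0` on `∂Ω × (0,τ)`,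
`u(0) = u_t(0) = 0`. The spatial test functions are the `w` with `w, Δw ∈ H¹₀(Ω)` and
`Δ² w ∈ L²(Ω)`; below `w₁ = Δ w`, `w₂ = Δ² w`, and `y` is the time derivative of `⟨u(t), w⟩`. -/
def IsSolution {d : ℕ} (Ω : Set (EuclideanSpace ℝ (Fin d))) (τ : ℝ) (ψ : ℝ → ℝ)
    (f : L2 Ω ℝ) (u : ℝ → L2 Ω ℝ) : Prop :=
  ContinuousOn u (Icc 0 τ) ∧ u 0 = 0 ∧
  ∀ w w₁ w₂ : L2 Ω ℝ, HasDirichletLaplacian Ω w w₁ → HasDirichletLaplacian Ω w₁ w₂ →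
    ∃ y : ℝ → ℝ, ContinuousOn y (Icc 0 τ) ∧ y 0 = 0 ∧
      ∀ t ∈ Ioo 0 τ,
        HasDerivAt (fun s => inner ℝ (u s) w) (y t) t ∧
        HasDerivAt (fun s => y s - 2 * inner ℝ (u s) w₁)
          (ψ t * inner ℝ f w - inner ℝ (u t) w₂) t

/-- `μ_l(t) = ∫₀ᵗ e^{-l (t-s)} (t-s) ψ(s) ds`. -/
def mu (ψ : ℝ → ℝ) (l t : ℝ) : ℝ :=
  ∫ s in (0 : ℝ)..t, Real.exp (-l * (t - s)) * (t - s) * ψ s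

/-- The norm of `ψ` in `C([0,τ])`. -/
def supNorm (τ : ℝ) (ψ : ℝ → ℝ) : ℝ := sSup ((fun t => |ψ t|) '' Icc 0 τ)

/-- The assumption on the time dependent factor: `|ψ|` is bounded below by `κ₁ > 0` near the final
time, and either `ψ` has a fixed sign, or `ψ` is differentiable on `[0,τ]` (finitely many corners
`S` are allowed) with bounded derivative and is small where its sign differs from that
of `ψ(τ)`. -/
def PsiAssumption (τ : ℝ) (ψ : ℝ → ℝ) : Prop :=
  ∃ τ₀ ∈ Ico 0 τ, ∃ κ₁ > 0, (∀ t ∈ Icc τ₀ τ, κ₁ ≤ |ψ t|) ∧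
    (((∀ t ∈ Icc 0 τ, 0 ≤ ψ t) ∨ (∀ t ∈ Icc 0 τ, ψ t ≤ 0)) ∨
      ((∃ κ₂ > 0, ∃ S : Set ℝ, S.Finite ∧ ∀ t ∈ Icc 0 τ \ S,
          DifferentiableWithinAt ℝ ψ (Icc 0 τ) t ∧ |derivWithin ψ (Icc 0 τ) t| ≤ κ₂) ∧
        ∀ t ∈ Icc 0 τ, ψ t * ψ τ ≤ 0 → |ψ t| ≤ (τ - τ₀) ^ 2 * κ₁ / (4 * τ * τ₀)))

/-- `g ∈ ℍ_q`, i.e. `∑ lam_n^{2q} |⟨g, φ_n⟩|² < ∞`. -/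
def InH {d : ℕ} {Ω : Set (EuclideanSpace ℝ (Fin d))} (lam : ℕ → ℝ)
    (φ : HilbertBasis ℕ ℝ (L2 Ω ℝ)) (q : ℝ) (g : L2 Ω ℝ) : Prop :=
  Summable fun n => lam n ^ (2 * q) * |inner ℝ g (φ n)| ^ 2

/-- The source set: `g ∈ ℍ_p` with `∑ lam_n^{2p} |⟨g, φ_n⟩|² ≤ ϱ²`. -/
def sourceSet {d : ℕ} {Ω : Set (EuclideanSpace ℝ (Fin d))} (lam : ℕ → ℝ)
    (φ : HilbertBasis ℕ ℝ (L2 Ω ℝ)) (ϱ p : ℝ) : Set (L2 Ω ℝ) :=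
  {g | InH lam φ p g ∧ ∑' n, lam n ^ (2 * p) * |inner ℝ g (φ n)| ^ 2 ≤ ϱ ^ 2}

/-- `v ∈ C([0,τ]; L²(Ω))` is the mild solution of
`v_tt - 2 Δ v_t + Δ² v = (I + α (-Δ)^b) ψ(t) g(x)`, `v = Δ v = 0` on `∂Ω × (0,τ)`,
`v(0) = v_t(0) = 0`, for `g ∈ ℍ_{b-2}`, which means that
`v(t) = ∑ (1 + α lam_n^b) μ_n(t) ⟨g, φ_n⟩ φ_n`. -/
def IsMildSolution {d : ℕ} {Ω : Set (EuclideanSpace ℝ (Fin d))} (lam : ℕ → ℝ)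
    (φ : HilbertBasis ℕ ℝ (L2 Ω ℝ)) (τ : ℝ) (ψ : ℝ → ℝ) (b α : ℝ)
    (g : L2 Ω ℝ) (v : ℝ → L2 Ω ℝ) : Prop :=
  InH lam φ (b - 2) g ∧ ContinuousOn v (Icc 0 τ) ∧
  ∀ t ∈ Icc 0 τ,
    HasSum (fun n => ((1 + α * lam n ^ b) * mu ψ (lam n) t * inner ℝ g (φ n)) • φ n) (v t)

/-- `g` is the source that the quasi-reversibility method with parameter `α` attaches to the
final value `k`: the mild solution with source `g` takes the value `k` at time `τ`. -/
def IsQRSource {d : ℕ} {Ω : Set (EuclideanSpace ℝ (Fin d))} (lam : ℕ → ℝ)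
    (φ : HilbertBasis ℕ ℝ (L2 Ω ℝ)) (τ : ℝ) (ψ : ℝ → ℝ) (b α : ℝ) (k g : L2 Ω ℝ) : Prop :=
  ∃ v : ℝ → L2 Ω ℝ, IsMildSolution lam φ τ ψ b α g v ∧ v τ = k

/-- `𝔹_α k = ∑ ⟨k, φ_n⟩ / (1 + α lam_n^b) φ_n`. -/
def opB {d : ℕ} {Ω : Set (EuclideanSpace ℝ (Fin d))} (lam : ℕ → ℝ)
    (φ : HilbertBasis ℕ ℝ (L2 Ω ℝ)) (b α : ℝ) (k : L2 Ω ℝ) : L2 Ω ℝ :=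
  ∑' n, (inner ℝ k (φ n) / (1 + α * lam n ^ b)) • φ n

/-- `C > 0` is a constant with `|μ_n(τ)| ≥ C / lam_n²` for all `n`. -/
def IsLowerConst (lam : ℕ → ℝ) (τ : ℝ) (ψ : ℝ → ℝ) (C : ℝ) : Prop :=
  0 < C ∧ ∀ n, C / lam n ^ 2 ≤ |mu ψ (lam n) τ|

end BiParabolic

end

/-! In the eigenbasis everything is diagonal: `h` has coefficients `μ_n f_n`, and the regularized
source `g` has coefficients `k_n / ((1 + α λ_n^b) μ_n)`, where `k` is the noisy datum. The symbol
`μ_n` is comparable to `λ_n^(-2)`: from above because the kernel has mass at most `λ_n^(-2)`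
(`abs_mu_le`), from below by the sign and smallness conditions on `ψ` (`mu_lower_of_pos_near`).

The error is split at `𝔹_α f`. Multiplied by `μ_n`, the coefficients of `𝔹_α f - f` become those of
the residual `𝔹_α h - h`, which the discrepancy principle bounds by `(ξ+1) D`. Interpolating this
`λ^(-2)`-weighted bound with the source condition gives the rate `p/(p+2)` without any knowledge of
`α` (`norm_sub_opB_le`).

The other part is at most `α^(-2/b) δ / C` (`norm_opB_sub_le`), so `α` must not be too small. The
same residual is at least `(ξ-1) D`, while a source condition of order `q ≤ b-2` bounds it by a
multiple of `α^((q+2)/b)` (`norm_opB_sub_self_le`); together these bound `α` from below. The filter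
saturates at `q = b-2`, hence the case distinction in (i). For `b = 2` only `q = 0` is left, and
level `D = δ` would give no decay of this part; therefore `D = δ^σ` in (ii). -/

namespace BiParabolic

/-! ### Poincaré inequality and Dirichlet eigenvalues -/

/-- The Poincaré inequality for smooth functions supported in a bounded set. -/
theorem integral_sq_le_of_tsupport_subset {d : ℕ} (i : Fin d) {Ω : Set (EuclideanSpace ℝ (Fin d))}
    {R : ℝ} (hR : ∀ x ∈ Ω, |x i| ≤ R) {θ : EuclideanSpace ℝ (Fin d) → ℝ} (hθ : ContDiff ℝ ∞ θ)
    (hc : HasCompactSupport θ) (hs : tsupport θ ⊆ Ω) :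
    ∫ x, θ x ^ 2 ≤ 4 * R ^ 2 * ∫ x, ‖gradient θ x‖ ^ 2 := by
  set e : EuclideanSpace ℝ (Fin d) := EuclideanSpace.single i 1
  have hθ1 : ContDiff ℝ 1 θ := hθ.of_le (by exact_mod_cast le_top)
  have hd : Differentiable ℝ θ := hθ1.differentiable one_ne_zero
  have hcf : Continuous (fderiv ℝ θ) := hθ1.continuous_fderiv one_ne_zero
  have hcd : Continuous (fun x => fderiv ℝ θ x e) := hcf.clm_apply continuous_const
  have hcg : Continuous (gradient θ) := by
    unfold gradient
    exact (LinearIsometryEquiv.continuous _).comp hcf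
  have hsq : HasCompactSupport (fun x => θ x ^ 2) := hc.comp_left (g := fun y : ℝ => y ^ 2) (by simp)
  have hcθ := hθ.continuous
  have hgs : HasCompactSupport (fun x => ‖gradient θ x‖ ^ 2) := by
    unfold gradient
    refine (hc.fderiv ℝ).comp_left
      (g := fun L => ‖(InnerProductSpace.toDual ℝ (EuclideanSpace ℝ (Fin d))).symm L‖ ^ 2) (by simp)
  have hcoord : ∀ x, HasFDerivAt (fun x : EuclideanSpace ℝ (Fin d) => x i)
      (EuclideanSpace.proj (𝕜 := ℝ) i) x := fun x =>
    (EuclideanSpace.proj i : EuclideanSpace ℝ (Fin d) →L[ℝ] ℝ).hasFDerivAt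
  have hci : Continuous (fun x : EuclideanSpace ℝ (Fin d) => x i) :=
    (EuclideanSpace.proj i : EuclideanSpace ℝ (Fin d) →L[ℝ] ℝ).continuous
  have h1 : ∀ x, fderiv ℝ (fun x : EuclideanSpace ℝ (Fin d) => x i) x e = 1 := fun x => by
    rw [(hcoord x).fderiv]; simp [e]
  have h2 : ∀ x, fderiv ℝ (fun x => θ x ^ 2) x e = 2 * θ x * fderiv ℝ θ x e := fun x => by
    rw [((hd x).hasFDerivAt.pow 2).fderiv]; simp
  have hint : Integrable (fun x => θ x ^ 2) :=
    (hcθ.pow 2).integrable_of_hasCompactSupport hsq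
  have hing : Integrable (fun x => ‖gradient θ x‖ ^ 2) :=
    (hcg.norm.pow 2).integrable_of_hasCompactSupport hgs
  have hin2 : Integrable (fun x : EuclideanSpace ℝ (Fin d) => x i * (2 * θ x * fderiv ℝ θ x e)) := by
    refine Continuous.integrable_of_hasCompactSupport (by fun_prop) ?_
    exact ((hc.mul_left (f := fun _ => 2)).mul_right (f' := fun x => fderiv ℝ θ x e)).mul_left
  -- Since `∂_i x_i = 1`, integration by parts gives `∫ θ² = -∫ x_i · 2 θ ∂_i θ`; Young's inequality
  -- below lets half of `∫ θ²` be absorbed on the left.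
  have key := integral_mul_fderiv_eq_neg_fderiv_mul_of_integrable (μ := volume)
    (f := fun x : EuclideanSpace ℝ (Fin d) => x i) (g := fun x => θ x ^ 2) (v := e)
    (by simpa only [h1, one_mul] using hint)
    (by simpa only [h2] using hin2)
    ((hci.mul (hcθ.pow 2)).integrable_of_hasCompactSupport hsq.mul_left)
    (fun x _ => (hcoord x).differentiableAt) (fun x _ => (hd x).pow 2)
  simp only [h1, one_mul, h2] at key
  have hpt : ∀ x : EuclideanSpace ℝ (Fin d), -(x i * (2 * θ x * fderiv ℝ θ x e)) ≤
      (1 / 2) * θ x ^ 2 + 2 * R ^ 2 * ‖gradient θ x‖ ^ 2 := by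
    intro x
    by_cases hx : x ∈ tsupport θ
    · have hb : |fderiv ℝ θ x e| ≤ ‖gradient θ x‖ := by
        have := (fderiv ℝ θ x).le_opNorm e
        have he : ‖e‖ = 1 := by simp [e]
        simpa [gradient, he] using this
      have hx2 : (x i) ^ 2 ≤ R ^ 2 := sq_le_sq' (abs_le.1 (hR x (hs hx))).1 (abs_le.1 (hR x (hs hx))).2
      have hD : (fderiv ℝ θ x e) ^ 2 ≤ ‖gradient θ x‖ ^ 2 := by
        rw [← sq_abs]; gcongr
      have := mul_le_mul hx2 hD (sq_nonneg _) (sq_nonneg _)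
      nlinarith [sq_nonneg (θ x + 2 * (x i * fderiv ℝ θ x e))]
    · rw [image_eq_zero_of_notMem_tsupport hx]
      simp only [mul_zero, zero_mul, neg_zero]
      positivity
  have := integral_mono hin2.neg ((hint.const_mul (1 / 2)).add (hing.const_mul (2 * R ^ 2))) hpt
  simp only [Pi.neg_apply, Pi.add_apply] at this
  rw [integral_neg, integral_add (hint.const_mul (1 / 2)) (hing.const_mul (2 * R ^ 2)),
    integral_const_mul, integral_const_mul] at this
  linarith

theorem L2_norm_sq {d : ℕ} {Ω : Set (EuclideanSpace ℝ (Fin d))} {F : Type} [NormedAddCommGroup F]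
    [InnerProductSpace ℝ F] (g : L2 Ω F) : ‖g‖ ^ 2 = ∫ x in Ω, ‖g x‖ ^ 2 := by
  rw [← real_inner_self_eq_norm_sq, L2.inner_def]
  simp

theorem norm_sq_le_of_mem_testGraph {d : ℕ} (i : Fin d) {Ω : Set (EuclideanSpace ℝ (Fin d))}
    {R : ℝ} (hR : ∀ x ∈ Ω, |x i| ≤ R) {q : L2 Ω ℝ × L2 Ω (EuclideanSpace ℝ (Fin d))}
    (h : q ∈ testGraph Ω) : ‖q.1‖ ^ 2 ≤ 4 * R ^ 2 * ‖q.2‖ ^ 2 := by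
  obtain ⟨θ, hθ, hc, hs, h1, h2⟩ := h
  have hsg : ∀ x ∉ Ω, gradient θ x = 0 := fun x hx => by
    rw [gradient, image_eq_zero_of_notMem_tsupport fun h => hx
      (hs (tsupport_fderiv_subset ℝ h)), map_zero]
  have e1 : ‖q.1‖ ^ 2 = ∫ x, θ x ^ 2 := by
    rw [L2_norm_sq, integral_congr_ae (g := fun x => θ x ^ 2)
      (h1.mono fun x hx => by simp only [hx, Real.norm_eq_abs, sq_abs])]
    refine setIntegral_eq_integral_of_forall_compl_eq_zero fun x hx => ?_
    rw [image_eq_zero_of_notMem_tsupport fun h => hx (hs h), zero_pow two_ne_zero]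
  have e2 : ‖q.2‖ ^ 2 = ∫ x, ‖gradient θ x‖ ^ 2 := by
    rw [L2_norm_sq, integral_congr_ae (g := fun x => ‖gradient θ x‖ ^ 2)
      (h2.mono fun x hx => by simp only [hx])]
    refine setIntegral_eq_integral_of_forall_compl_eq_zero fun x hx => ?_
    rw [hsg x hx, norm_zero, zero_pow two_ne_zero]
  rw [e1, e2]
  exact integral_sq_le_of_tsupport_subset i hR hθ hc hs

/-- The Poincaré inequality in `H¹₀(Ω)` for bounded `Ω`. -/
theorem exists_norm_sq_le_of_mem_H10 {d : ℕ} (hd : 1 ≤ d) {Ω : Set (EuclideanSpace ℝ (Fin d))}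
    (hb : Bornology.IsBounded Ω) :
    ∃ K : ℝ, ∀ q ∈ H10 Ω, ‖q.1‖ ^ 2 ≤ K * ‖q.2‖ ^ 2 := by
  obtain ⟨R, hR⟩ := hb.exists_norm_le
  refine ⟨4 * R ^ 2, fun p h => ?_⟩
  have hclosed : IsClosed {q : L2 Ω ℝ × L2 Ω (EuclideanSpace ℝ (Fin d)) |
      ‖q.1‖ ^ 2 ≤ 4 * R ^ 2 * ‖q.2‖ ^ 2} :=
    isClosed_le (continuous_fst.norm.pow 2) (continuous_const.mul (continuous_snd.norm.pow 2))
  exact closure_minimal (fun q hq => norm_sq_le_of_mem_testGraph ⟨0, hd⟩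
    (fun x hx => (PiLp.norm_apply_le x _).trans (hR x hx)) hq) hclosed h

/-- Testing the eigenvalue equation with `φ n` itself gives `lam n = ‖∇φ n‖² ≥ 0`, and the Poincaré
inequality excludes `0` because `‖φ n‖ = 1`. -/
theorem IsDirichletEigenbasis.pos {d : ℕ} (hd : 1 ≤ d) {Ω : Set (EuclideanSpace ℝ (Fin d))}
    (hb : Bornology.IsBounded Ω) {lam : ℕ → ℝ} {φ : HilbertBasis ℕ ℝ (L2 Ω ℝ)}
    (h : IsDirichletEigenbasis Ω lam φ) (n : ℕ) : 0 < lam n := by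
  obtain ⟨K, hK⟩ := exists_norm_sq_le_of_mem_H10 hd hb
  obtain ⟨G, hG, hv⟩ := h.2 n
  have h1 : ‖φ n‖ = 1 := φ.orthonormal.1 n
  have e := hv _ _ hG
  rw [inner_neg_left, inner_smul_left, real_inner_self_eq_norm_sq, real_inner_self_eq_norm_sq,
    h1] at e
  simp only [conj_trivial, one_pow, mul_one, neg_neg] at e
  have := hK _ hG
  rw [h1, e] at this
  by_contra hn
  have h0 : lam n = 0 := le_antisymm (not_lt.1 hn) (e ▸ sq_nonneg _)
  rw [h0] at this
  norm_num at this

/-- Applied to `w₁ = -l w`, this yields `Δ² w = l² w` for an eigenfunction, which makes it an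
admissible test function for the weak solution. -/
theorem HasDirichletLaplacian.smul {d : ℕ} {Ω : Set (EuclideanSpace ℝ (Fin d))} {w g : L2 Ω ℝ}
    (h : HasDirichletLaplacian Ω w g) (c : ℝ) : HasDirichletLaplacian Ω (c • w) (c • g) := by
  obtain ⟨G, hG, hv⟩ := h
  refine ⟨c • G, ?_, fun v V hV => by
    rw [inner_smul_left, inner_smul_left, hv v V hV, mul_neg]⟩
  have hmap : MapsTo (fun q : L2 Ω ℝ × L2 Ω (EuclideanSpace ℝ (Fin d)) => c • q)
      (testGraph Ω) (testGraph Ω) := by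
    rintro q ⟨θ, hθ, hc, hs, h1, h2⟩
    refine ⟨c • θ, hθ.const_smul c, hc.smul_left (f := fun _ => c), ?_, ?_, ?_⟩
    · exact (closure_mono (Function.support_const_smul_subset c θ)).trans hs
    · filter_upwards [Lp.coeFn_smul c q.1, h1] with x hx h1x
      rw [Prod.smul_fst, hx, Pi.smul_apply, Pi.smul_apply, h1x]
    · filter_upwards [Lp.coeFn_smul c q.2, h2] with x hx h2x
      rw [Prod.smul_snd, hx, Pi.smul_apply, h2x, gradient, gradient,
        fderiv_const_smul ((hθ.differentiable (by simp)) x)]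
      simp
  exact map_mem_closure (f := fun q : L2 Ω ℝ × L2 Ω (EuclideanSpace ℝ (Fin d)) => c • q)
    (continuous_const_smul c) hG hmap

/-! ### Two-sided bounds for `μ` -/

theorem continuous_kernel (l t : ℝ) : Continuous fun s : ℝ => Real.exp (-l * (t - s)) * (t - s) := by
  fun_prop

theorem integral_kernel {l : ℝ} (hl : l ≠ 0) (c t : ℝ) :
    ∫ s in c..t, Real.exp (-l * (t - s)) * (t - s) =
      (1 - Real.exp (-(l * (t - c))) * (1 + l * (t - c))) / l ^ 2 := by
  have hder : ∀ s ∈ uIcc c t, HasDerivAt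
      (fun s => Real.exp (-l * (t - s)) * (1 + l * (t - s)) / l ^ 2)
      (Real.exp (-l * (t - s)) * (t - s)) s := by
    intro s _
    have h1 : HasDerivAt (fun s => t - s) (-1) s := by simpa using (hasDerivAt_id s).const_sub t
    have h2 := (h1.const_mul (-l)).exp
    have h3 := (h1.const_mul l).const_add 1
    refine ((h2.mul h3).div_const (l ^ 2)).congr_deriv ?_
    rw [div_eq_iff (pow_ne_zero 2 hl)]
    ring
  rw [intervalIntegral.integral_eq_sub_of_hasDerivAt hder
    ((continuous_kernel l t).intervalIntegrable _ _)]
  simp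
  ring

theorem half_sq_mul_exp_neg_le {x : ℝ} (hx : 0 ≤ x) :
    Real.exp (-x) * (x ^ 2 / 2) ≤ 1 - Real.exp (-x) * (1 + x) := by
  have h1 := Real.quadratic_le_exp_of_nonneg hx
  have h2 : Real.exp (-x) * Real.exp x = 1 := by rw [← Real.exp_add]; simp
  nlinarith [mul_le_mul_of_nonneg_left h1 (Real.exp_pos (-x)).le]

/-- Monotonicity lets the lower constant found at the smallest eigenvalue serve for all of them. -/
theorem one_sub_exp_neg_mul_mono {x y : ℝ} (hx : 0 ≤ x) (hxy : x ≤ y) :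
    1 - Real.exp (-x) * (1 + x) ≤ 1 - Real.exp (-y) * (1 + y) := by
  have h1 : 1 + y ≤ (1 + x) * Real.exp (y - x) := by
    nlinarith [mul_le_mul_of_nonneg_left (Real.add_one_le_exp (y - x)) (by linarith : 0 ≤ 1 + x),
      mul_nonneg hx (sub_nonneg.2 hxy)]
  have h2 : Real.exp (-y) * Real.exp (y - x) = Real.exp (-x) := by rw [← Real.exp_add]; ring_nf
  nlinarith [mul_le_mul_of_nonneg_left h1 (Real.exp_pos (-y)).le]

theorem abs_le_supNorm {τ : ℝ} {ψ : ℝ → ℝ} (hψ : ContinuousOn ψ (Icc 0 τ)) {t : ℝ}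
    (ht : t ∈ Icc 0 τ) : |ψ t| ≤ supNorm τ ψ :=
  le_csSup (isCompact_Icc.bddAbove_image hψ.abs) (mem_image_of_mem _ ht)

theorem abs_mu_le {τ l t : ℝ} {ψ : ℝ → ℝ} (hψ : ContinuousOn ψ (Icc 0 τ)) (hl : 0 < l)
    (ht : t ∈ Icc 0 τ) : |mu ψ l t| ≤ supNorm τ ψ / l ^ 2 := by
  have h0 : 0 ≤ supNorm τ ψ := (abs_nonneg _).trans (abs_le_supNorm hψ ht)
  have h1 : ‖mu ψ l t‖ ≤ ∫ s in (0 : ℝ)..t, supNorm τ ψ * (Real.exp (-l * (t - s)) * (t - s)) := by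
    refine intervalIntegral.norm_integral_le_of_norm_le ht.1 (ae_of_all _ fun s hs => ?_)
      ((continuous_const.mul (continuous_kernel l t)).intervalIntegrable _ _)
    have hk : 0 ≤ Real.exp (-l * (t - s)) * (t - s) :=
      mul_nonneg (Real.exp_pos _).le (sub_nonneg.2 hs.2)
    rw [norm_mul, Real.norm_of_nonneg hk, mul_comm]
    exact mul_le_mul_of_nonneg_right (abs_le_supNorm hψ ⟨hs.1.le, hs.2.trans ht.2⟩) hk
  rw [intervalIntegral.integral_const_mul, integral_kernel hl.ne', Real.norm_eq_abs] at h1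
  refine h1.trans ?_
  rw [div_eq_mul_one_div (supNorm τ ψ)]
  gcongr
  have : 0 ≤ l * (t - 0) := mul_nonneg hl.le (by simpa using ht.1)
  have := mul_nonneg (Real.exp_pos (-(l * (t - 0)))).le (by linarith : 0 ≤ 1 + l * (t - 0))
  linarith

theorem continuousOn_mu {τ l : ℝ} {ψ : ℝ → ℝ} (hτ : 0 ≤ τ) (hψ : ContinuousOn ψ (Icc 0 τ)) :
    ContinuousOn (mu ψ l) (Icc 0 τ) := by
  -- The kernel separates into products of functions of `t` and of `s`, so continuity reduces to
  -- that of primitives.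
  have hE : ∀ t s : ℝ, Real.exp (-l * (t - s)) * (t - s) * ψ s =
      Real.exp (-l * t) * t * (Real.exp (l * s) * ψ s) -
        Real.exp (-l * t) * (Real.exp (l * s) * s * ψ s) := by
    intro t s
    rw [show -l * (t - s) = -l * t + l * s by ring, Real.exp_add]; ring
  have hi : ∀ g : ℝ → ℝ, ContinuousOn g (Icc 0 τ) →
      ContinuousOn (fun t => ∫ s in (0 : ℝ)..t, g s) (Icc 0 τ) := by
    intro g hg
    rw [← uIcc_of_le hτ] at hg ⊢
    exact intervalIntegral.continuousOn_primitive_interval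
      (hg.integrableOn_compact isCompact_uIcc)
  have h1 : ContinuousOn (fun s => Real.exp (l * s) * ψ s) (Icc 0 τ) :=
    ContinuousOn.mul (by fun_prop) hψ
  have h2 : ContinuousOn (fun s => Real.exp (l * s) * s * ψ s) (Icc 0 τ) :=
    ContinuousOn.mul (by fun_prop) hψ
  refine (((ContinuousOn.mul (by fun_prop) (hi _ h1)).sub
    (ContinuousOn.mul (by fun_prop) (hi _ h2))) :
    ContinuousOn (fun t => Real.exp (-l * t) * t * (∫ s in (0 : ℝ)..t, Real.exp (l * s) * ψ s) -
      Real.exp (-l * t) * ∫ s in (0 : ℝ)..t, Real.exp (l * s) * s * ψ s) _).congr ?_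
  intro t ht
  have hsub : uIcc 0 t ⊆ Icc 0 τ := by rw [uIcc_of_le ht.1]; exact Icc_subset_Icc_right ht.2
  simp only [mu, hE]
  have i1 : IntervalIntegrable _ volume 0 t := (h1.mono hsub).intervalIntegrable
  have i2 : IntervalIntegrable _ volume 0 t := (h2.mono hsub).intervalIntegrable
  rw [intervalIntegral.integral_sub (i1.const_mul _) (i2.const_mul _),
    intervalIntegral.integral_const_mul, intervalIntegral.integral_const_mul]
  rfl

/-- With `x = l (τ - τ₀)` and `J = 1 - e^(-x) (1 + x)`, the interval `[τ₀, τ]` contributes at least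
`κ J / l²`. On `[0, τ₀]` the kernel is at most `τ e^(-x)`, so the loss there is at most `M τ₀ τ
e^(-x)`. By `hsmall` and `e^(-x) x²/2 ≤ J` this is at most half of the gain, uniformly in `l`. -/
theorem mu_lower_of_pos_near {τ τ₀ κ M l : ℝ} {ψ : ℝ → ℝ} (hψ : ContinuousOn ψ (Icc 0 τ))
    (hτ₀ : τ₀ ∈ Ico 0 τ) (hκ : 0 < κ) (hM : 0 ≤ M) (hl : 0 < l)
    (hpos : ∀ t ∈ Icc τ₀ τ, κ ≤ ψ t) (hneg : ∀ t ∈ Icc 0 τ₀, -M ≤ ψ t)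
    (hsmall : M * τ₀ * τ ≤ κ * (τ - τ₀) ^ 2 / 4) :
    κ / 2 * (1 - Real.exp (-(l * (τ - τ₀))) * (1 + l * (τ - τ₀))) / l ^ 2 ≤ mu ψ l τ := by
  have hx : 0 ≤ l * (τ - τ₀) := mul_nonneg hl.le (sub_nonneg.2 hτ₀.2.le)
  have hJ := half_sq_mul_exp_neg_le hx
  set J := (1 - Real.exp (-(l * (τ - τ₀))) * (1 + l * (τ - τ₀))) with hJdef
  have hc : ContinuousOn (fun s => Real.exp (-l * (τ - s)) * (τ - s) * ψ s) (Icc 0 τ) :=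
    (continuous_kernel l τ).continuousOn.mul hψ
  have i1 : IntervalIntegrable (fun s => Real.exp (-l * (τ - s)) * (τ - s) * ψ s) volume 0 τ₀ :=
    (hc.mono (by rw [uIcc_of_le hτ₀.1]; exact Icc_subset_Icc_right hτ₀.2.le)).intervalIntegrable
  have i2 : IntervalIntegrable (fun s => Real.exp (-l * (τ - s)) * (τ - s) * ψ s) volume τ₀ τ :=
    (hc.mono (by rw [uIcc_of_le hτ₀.2.le]; exact Icc_subset_Icc_left hτ₀.1)).intervalIntegrable
  have b2 : κ * (J / l ^ 2) ≤ ∫ s in τ₀..τ, Real.exp (-l * (τ - s)) * (τ - s) * ψ s := by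
    rw [← integral_kernel hl.ne', ← intervalIntegral.integral_const_mul]
    refine intervalIntegral.integral_mono_on hτ₀.2.le
      ((continuous_const.mul (continuous_kernel l τ)).intervalIntegrable _ _) i2 fun s hs => ?_
    rw [mul_comm κ]
    exact mul_le_mul_of_nonneg_left (hpos s hs)
      (mul_nonneg (Real.exp_pos _).le (sub_nonneg.2 hs.2))
  have b1 : -(M * τ₀ * τ * Real.exp (-(l * (τ - τ₀)))) ≤
      ∫ s in (0 : ℝ)..τ₀, Real.exp (-l * (τ - s)) * (τ - s) * ψ s := by
    have : ∫ _ in (0 : ℝ)..τ₀, -(M * τ * Real.exp (-(l * (τ - τ₀)))) ≤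
        ∫ s in (0 : ℝ)..τ₀, Real.exp (-l * (τ - s)) * (τ - s) * ψ s := by
      refine intervalIntegral.integral_mono_on hτ₀.1 (by simp) i1 fun s hs => ?_
      have hk0 : 0 ≤ τ - s := sub_nonneg.2 (hs.2.trans hτ₀.2.le)
      have hk : Real.exp (-l * (τ - s)) * (τ - s) ≤ Real.exp (-(l * (τ - τ₀))) * τ := by
        refine mul_le_mul (Real.exp_le_exp.2 ?_) (by linarith [hs.1]) hk0 (Real.exp_pos _).le
        nlinarith [mul_le_mul_of_nonneg_left hs.2 hl.le]
      have h1 := mul_le_mul_of_nonneg_left (hneg s hs) (mul_nonneg (Real.exp_pos (-l * (τ - s))).le hk0)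
      nlinarith [mul_le_mul_of_nonneg_right hk hM]
    rw [intervalIntegral.integral_const] at this
    simp only [sub_zero, smul_eq_mul] at this
    linarith
  have hsplit : mu ψ l τ = _ := (intervalIntegral.integral_add_adjacent_intervals i1 i2).symm
  rw [hsplit]
  have hfin : M * τ₀ * τ * Real.exp (-(l * (τ - τ₀))) ≤ κ / 2 * (J / l ^ 2) := by
    rw [← mul_div_assoc, le_div_iff₀ (by positivity)]
    nlinarith [mul_le_mul_of_nonneg_right hsmall
      (mul_nonneg (Real.exp_pos (-(l * (τ - τ₀)))).le (sq_nonneg l)),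
      mul_le_mul_of_nonneg_left hJ hκ.le]
  rw [mul_div_assoc]
  linarith

theorem mu_neg (ψ : ℝ → ℝ) (l t : ℝ) : mu (fun s => -ψ s) l t = -mu ψ l t := by
  simp only [mu, mul_neg, intervalIntegral.integral_neg]

/-- Up to the sign of `ψ`, the assumption on `ψ` gives the hypotheses of
`mu_lower_of_pos_near`. -/
theorem PsiAssumption.exists_lower {τ : ℝ} {ψ : ℝ → ℝ} (hψ : ContinuousOn ψ (Icc 0 τ))
    (h : PsiAssumption τ ψ) :
    ∃ κ > 0, ∃ a > 0, ∀ l > 0, κ * (1 - Real.exp (-(l * a)) * (1 + l * a)) / l ^ 2 ≤ |mu ψ l τ| := by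
  obtain ⟨τ₀, hτ₀, κ, hκ, hlow, hcase⟩ := h
  have hsubset : Icc τ₀ τ ⊆ Icc 0 τ := Icc_subset_Icc_left hτ₀.1
  have hsubset0 : Icc 0 τ₀ ⊆ Icc 0 τ := Icc_subset_Icc_right hτ₀.2.le
  have hτ : 0 < τ := hτ₀.1.trans_lt hτ₀.2
  have hend : τ ∈ Icc τ₀ τ := ⟨hτ₀.2.le, le_rfl⟩
  refine ⟨κ / 2, by positivity, τ - τ₀, sub_pos.2 hτ₀.2, fun l hl => ?_⟩
  have main : ∀ χ : ℝ → ℝ, ContinuousOn χ (Icc 0 τ) → (∀ t ∈ Icc τ₀ τ, κ ≤ |χ t|) → 0 < χ τ →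
      ((∀ t ∈ Icc 0 τ, 0 ≤ χ t) ∨
        (∀ t ∈ Icc 0 τ, χ t ≤ 0 → |χ t| ≤ (τ - τ₀) ^ 2 * κ / (4 * τ * τ₀))) →
      κ / 2 * (1 - Real.exp (-(l * (τ - τ₀))) * (1 + l * (τ - τ₀))) / l ^ 2 ≤ mu χ l τ := by
    intro χ hχ hχlow hχτ hc
    have hpos : ∀ t ∈ Icc τ₀ τ, κ ≤ χ t := by
      intro t ht
      -- A sign change on `[τ₀, τ]` would force a zero there, contradicting `κ ≤ |χ|`.
      have ht0 : 0 < χ t := by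
        by_contra hneg
        have hsub : Icc t τ ⊆ Icc τ₀ τ := Icc_subset_Icc_left ht.1
        obtain ⟨s, hs, hs0⟩ := intermediate_value_Icc ht.2 (hχ.mono (hsub.trans hsubset))
          (show (0 : ℝ) ∈ Icc (χ t) (χ τ) from ⟨not_lt.1 hneg, hχτ.le⟩)
        have := hχlow s (hsub hs)
        rw [hs0, abs_zero] at this
        linarith
      simpa [abs_of_pos ht0] using hχlow t ht
    rcases hc with hc | hc
    · exact mu_lower_of_pos_near hχ hτ₀ hκ le_rfl hl hpos
        (fun t ht => by simpa using hc t (hsubset0 ht)) (by simp; positivity)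
    · have hM : 0 ≤ (τ - τ₀) ^ 2 * κ / (4 * τ * τ₀) :=
        div_nonneg (by positivity) (mul_nonneg (by positivity) hτ₀.1)
      refine mu_lower_of_pos_near hχ hτ₀ hκ hM hl hpos (fun t ht => ?_) ?_
      · rcases le_total (χ t) 0 with h0 | h0
        · exact (abs_le.1 (hc t (hsubset0 ht) h0)).1
        · linarith
      -- For `τ₀ = 0` the quotient defining the bound is `0` by convention, and the interval `[0,
      -- τ₀]` contributes nothing.
      · rcases hτ₀.1.eq_or_lt with h0 | h0
        · rw [← h0]; simp; positivity
        · apply le_of_eq; field_simp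
  have hτne : ψ τ ≠ 0 := fun h0 => by
    have := hlow τ hend
    rw [h0, abs_zero] at this
    linarith
  rcases hτne.lt_or_gt with hs | hs
  · refine (main (fun s => -ψ s) hψ.neg (by simpa using hlow) (by simpa using hs) ?_).trans
      (by rw [mu_neg]; exact neg_le_abs _)
    rcases hcase with (h1 | h1) | ⟨-, h1⟩
    · exact absurd (h1 τ (hsubset hend)) (not_le.2 hs)
    · exact Or.inl fun t ht => neg_nonneg.2 (h1 t ht)
    · refine Or.inr fun t ht ht0 => ?_
      rw [abs_neg]
      exact h1 t ht (mul_nonpos_of_nonneg_of_nonpos (by linarith) hs.le)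
  · refine (main ψ hψ hlow hs ?_).trans (le_abs_self _)
    rcases hcase with (h1 | h1) | ⟨-, h1⟩
    · exact Or.inl h1
    · exact absurd (h1 τ (hsubset hend)) (not_le.2 hs)
    · exact Or.inr fun t ht ht0 => h1 t ht (mul_nonpos_of_nonpos_of_nonneg ht0 hs.le)

theorem exists_isLowerConst {lam : ℕ → ℝ} (hmono : Monotone lam) (hpos : 0 < lam 0) {τ : ℝ}
    {ψ : ℝ → ℝ} (hψ : ContinuousOn ψ (Icc 0 τ)) (h : PsiAssumption τ ψ) :
    ∃ C, IsLowerConst lam τ ψ C := by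
  obtain ⟨κ, hκ, a, ha, hlow⟩ := h.exists_lower hψ
  have hx : 0 < lam 0 * a := by positivity
  refine ⟨κ * (1 - Real.exp (-(lam 0 * a)) * (1 + lam 0 * a)),
    mul_pos hκ (lt_of_lt_of_le (by positivity) (half_sq_mul_exp_neg_le hx.le)), fun n => ?_⟩
  have hn := hmono (Nat.zero_le n)
  refine le_trans ?_ (hlow (lam n) (hpos.trans_le hn))
  gcongr ?_ / _
  exact mul_le_mul_of_nonneg_left (one_sub_exp_neg_mul_mono hx.le (by gcongr)) hκ.le

/-! ### Reduction of the weak solution to a scalar equation -/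

/-- The Fourier coefficients of the final value of the weak solution. -/
theorem IsSolution.inner_final {d : ℕ} {Ω : Set (EuclideanSpace ℝ (Fin d))} {τ : ℝ} (hτ : 0 < τ)
    {ψ : ℝ → ℝ} (hψ : ContinuousOn ψ (Icc 0 τ)) {f : L2 Ω ℝ} {u : ℝ → L2 Ω ℝ}
    (hu : IsSolution Ω τ ψ f u) {w : L2 Ω ℝ} {l : ℝ}
    (hw : HasDirichletLaplacian Ω w (-(l • w))) :
    inner ℝ (u τ) w = mu ψ l τ * inner ℝ f w := by
  obtain ⟨hcont, hu0, hsol⟩ := hu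
  have hw2 := hw.smul (-l)
  rw [neg_smul] at hw2
  obtain ⟨y, hyc, hy0, hy⟩ := hsol w _ _ hw hw2
  set F : ℝ := inner ℝ f w
  set x : ℝ → ℝ := fun t => inner ℝ (u t) w with hxdef
  have hxc : ContinuousOn x (Icc 0 τ) := hcont.inner continuousOn_const
  -- Here `x'' + 2 l x' + l² x = ψ F`. The kernel `e^(l t) (τ - t)` solves the adjoint equation, so
  -- multiplying by it makes the left side an exact derivative. The primitive vanishes at `0` and
  -- leaves only `e^(l τ) x τ` at `τ`.
  have hder : ∀ t ∈ Ioo 0 τ, HasDerivAt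
      (fun t => Real.exp (l * t) * (x t + (τ - t) * (y t + l * x t)))
      (Real.exp (l * t) * (τ - t) * ψ t * F) t := by
    intro t ht
    obtain ⟨h1, h2⟩ := hy t ht
    simp only [inner_neg_right, inner_smul_right, neg_smul, smul_neg, neg_neg] at h2
    have h1 : HasDerivAt x (y t) t := h1
    have hy' : HasDerivAt y (ψ t * F - l * (l * x t) - 2 * l * y t) t := by
      refine (h2.sub (h1.const_mul (2 * l))).congr_of_eventuallyEq
        (Eventually.of_forall fun s => ?_)
      simp only [Pi.sub_apply, hxdef]
      ring
    have ht1 : HasDerivAt (fun s => τ - s) (-1) t := by simpa using (hasDerivAt_id t).const_sub τ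
    have he : HasDerivAt (fun s => Real.exp (l * s)) (Real.exp (l * t) * l) t := by
      simpa using ((hasDerivAt_id t).const_mul l).exp
    refine (he.mul (h1.add (ht1.mul (hy'.add (h1.const_mul l))))).congr_deriv ?_
    simp only [Pi.add_apply, Pi.mul_apply]
    ring
  have hint := intervalIntegral.integral_eq_sub_of_hasDerivAt_of_le hτ.le
    (f := fun t => Real.exp (l * t) * (x t + (τ - t) * (y t + l * x t)))
    (ContinuousOn.mul (by fun_prop) (hxc.add (ContinuousOn.mul (by fun_prop)
      (hyc.add (continuousOn_const.mul hxc))))) hder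
    (ContinuousOn.intervalIntegrable (by
      rw [uIcc_of_le hτ.le]
      exact (ContinuousOn.mul (by fun_prop) hψ).mul continuousOn_const))
  have hx0 : x 0 = 0 := by simp [hxdef, hu0]
  simp only [hx0, hy0, sub_self, zero_mul, add_zero, mul_zero, sub_zero] at hint
  have hmu : mu ψ l τ * F = Real.exp (-(l * τ)) *
      ∫ t in (0 : ℝ)..τ, Real.exp (l * t) * (τ - t) * ψ t * F := by
    rw [mu, ← intervalIntegral.integral_mul_const, ← intervalIntegral.integral_const_mul]
    refine intervalIntegral.integral_congr fun s _ => ?_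
    rw [show -l * (τ - s) = -(l * τ) + l * s by ring, Real.exp_add]
    ring
  rw [hmu, hint, ← mul_assoc, ← Real.exp_add]
  simp [hxdef]

/-! ### Coefficient estimates, interpolation and the discrepancy function -/

section HilbertBasis

variable {E : Type*} [NormedAddCommGroup E] [InnerProductSpace ℝ E] (φ : HilbertBasis ℕ ℝ E)

theorem hasSum_inner_sq (x : E) : HasSum (fun n => inner ℝ x (φ n) ^ 2) (‖x‖ ^ 2) := by
  have := φ.hasSum_inner_mul_inner x x
  rw [real_inner_self_eq_norm_sq] at this
  refine this.congr_fun fun n => ?_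
  rw [real_inner_comm x (φ n), sq]

theorem ext_inner {x y : E} (h : ∀ n, inner ℝ x (φ n) = inner ℝ y (φ n)) : x = y := by
  rw [← sub_eq_zero, ← norm_eq_zero, ← sq_eq_zero_iff]
  refine (hasSum_inner_sq φ (x - y)).unique ?_
  simp [inner_sub_left, h]

theorem norm_le_of_inner_sq_le {x : E} {a : ℕ → ℝ} {c : ℝ} (hc : 0 ≤ c) (ha : Summable a)
    (hle : ∀ n, inner ℝ x (φ n) ^ 2 ≤ a n) (hs : ∑' n, a n ≤ c ^ 2) : ‖x‖ ≤ c := by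
  refine le_of_sq_le_sq ?_ hc
  exact ((hasSum_le hle (hasSum_inner_sq φ x) ha.hasSum)).trans hs

theorem norm_le_mul_of_abs_inner_le {x y : E} {c : ℝ} (hc : 0 ≤ c)
    (h : ∀ n, |inner ℝ x (φ n)| ≤ c * |inner ℝ y (φ n)|) : ‖x‖ ≤ c * ‖y‖ := by
  have hs := (hasSum_inner_sq φ y).mul_left (c ^ 2)
  refine norm_le_of_inner_sq_le φ (by positivity) hs.summable (fun n => ?_)
    (by rw [hs.tsum_eq, mul_pow])
  rw [← sq_abs, ← sq_abs (inner ℝ y (φ n)), ← mul_pow]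
  exact pow_le_pow_left₀ (abs_nonneg _) (h n) 2

theorem inner_of_hasSum {c : ℕ → ℝ} {x : E} (h : HasSum (fun n => c n • φ n) x) (n : ℕ) :
    inner ℝ x (φ n) = c n := by
  have h1 := h.mapL (innerSL ℝ (φ n))
  simp only [innerSL_apply_apply, inner_smul_right] at h1
  rw [real_inner_comm]
  refine h1.unique ?_
  convert hasSum_single n ?_ using 1
  · simp [φ.orthonormal.1 n]
  · intro m hm
    simp [φ.orthonormal.2 hm.symm]

theorem exists_hasSum_of_summable_sq {c : ℕ → ℝ} (hc : Summable fun n => c n ^ 2) :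
    ∃ x : E, HasSum (fun n => c n • φ n) x := by
  have hm : Memℓp c 2 := by
    refine memℓp_gen ?_
    simpa using hc
  exact ⟨_, φ.hasSum_repr_symm ⟨c, hm⟩⟩

/-- By Parseval, `‖v t - v t₀‖²` is a series of continuous terms dominated by `4 B n ^ 2`. -/
theorem continuousOn_of_inner {s : Set ℝ} {v : ℝ → E} {B : ℕ → ℝ}
    (hB : Summable fun n => B n ^ 2) (hc : ∀ n, ContinuousOn (fun t => inner ℝ (v t) (φ n)) s)
    (hb : ∀ t ∈ s, ∀ n, |inner ℝ (v t) (φ n)| ≤ B n) : ContinuousOn v s := by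
  intro t₀ ht₀
  have h1 : Tendsto (fun t => ∑' n, inner ℝ (v t - v t₀) (φ n) ^ 2) (𝓝[s] t₀)
      (𝓝 (∑' _ : ℕ, (0 : ℝ))) := by
    refine tendsto_tsum_of_dominated_convergence (hB.mul_left 4) (fun n => ?_) ?_
    · have h := ((hc n t₀ ht₀).tendsto.sub_const (inner ℝ (v t₀) (φ n))).pow 2
      rw [sub_self, zero_pow two_ne_zero] at h
      simpa only [inner_sub_left] using h
    · filter_upwards [self_mem_nhdsWithin] with t ht n
      rw [Real.norm_eq_abs, abs_of_nonneg (sq_nonneg _), inner_sub_left]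
      have h2 := abs_le.1 (hb t ht n)
      have h3 := abs_le.1 (hb t₀ ht₀ n)
      nlinarith [sq_le_sq' (show -(2 * B n) ≤ inner ℝ (v t) (φ n) - inner ℝ (v t₀) (φ n) by linarith)
        (by linarith)]
  simp only [(hasSum_inner_sq φ _).tsum_eq, tsum_zero] at h1
  rw [ContinuousWithinAt, tendsto_iff_norm_sub_tendsto_zero]
  have h2 := h1.sqrt
  simpa [Real.sqrt_sq] using h2

/-- An interpolation inequality between the norms with weights `lam ^ p` and `lam ^ (-2)`. -/
theorem norm_le_of_interpolation {lam : ℕ → ℝ} (hlam : ∀ n, 0 < lam n) {p A B : ℝ} (hp : 0 < p)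
    (hA : 0 < A) (hB : 0 < B) {x : E}
    (h1 : Summable fun n => lam n ^ (2 * p) * inner ℝ x (φ n) ^ 2)
    (h1' : ∑' n, lam n ^ (2 * p) * inner ℝ x (φ n) ^ 2 ≤ A ^ 2)
    (h2 : Summable fun n => (inner ℝ x (φ n) / lam n ^ 2) ^ 2)
    (h2' : ∑' n, (inner ℝ x (φ n) / lam n ^ 2) ^ 2 ≤ B ^ 2) :
    ‖x‖ ≤ A ^ (2 / (p + 2)) * B ^ (p / (p + 2)) := by
  set θ := 2 / (p + 2) with hθ
  set η := p / (p + 2) with hη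
  have hp2 : 0 < p + 2 := by linarith
  have hθη : θ + η = 1 := by rw [hθ, hη]; field_simp; ring
  have hθ0 : 0 ≤ θ := by positivity
  have hη0 : 0 ≤ η := by positivity
  have hsum := ((h1.mul_left (θ / A ^ 2)).add (h2.mul_left (η / B ^ 2))).mul_left
    ((A ^ θ * B ^ η) ^ 2)
  refine norm_le_of_inner_sq_le φ (by positivity) hsum (fun n => ?_) ?_
  · set y := inner ℝ x (φ n) ^ 2 with hy
    have hy0 : 0 ≤ y := sq_nonneg _
    have hl := hlam n
    have hA2 : (A ^ θ) ^ 2 = (A ^ 2) ^ θ := by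
      rw [← Real.rpow_natCast, ← Real.rpow_natCast, ← Real.rpow_mul hA.le, ← Real.rpow_mul hA.le,
        mul_comm]
    have hB2 : (B ^ η) ^ 2 = (B ^ 2) ^ η := by
      rw [← Real.rpow_natCast, ← Real.rpow_natCast, ← Real.rpow_mul hB.le, ← Real.rpow_mul hB.le,
        mul_comm]
    -- Weighted AM-GM mode by mode: the powers of `lam n` cancel in the geometric mean because `2 p
    -- θ = 4 η`.
    have am := Real.geom_mean_le_arith_mean2_weighted hθ0 hη0
      (show 0 ≤ lam n ^ (2 * p) * y / A ^ 2 by positivity)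
      (show 0 ≤ y / (lam n ^ 2) ^ 2 / B ^ 2 by positivity) hθη
    have hprod : (lam n ^ (2 * p) * y / A ^ 2) ^ θ * (y / (lam n ^ 2) ^ 2 / B ^ 2) ^ η =
        y / ((A ^ θ * B ^ η) ^ 2) := by
      rw [Real.div_rpow (by positivity) (by positivity), Real.div_rpow (by positivity) (by positivity),
        Real.div_rpow (by positivity) (by positivity), Real.mul_rpow (by positivity) hy0, mul_pow, hA2,
        hB2]
      have e1 : y ^ θ * y ^ η = y := by
        rw [← Real.rpow_add_of_nonneg hy0 hθ0 hη0, hθη, Real.rpow_one]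
      have e2 : (lam n ^ (2 * p)) ^ θ = ((lam n ^ 2) ^ 2) ^ η := by
        rw [← pow_mul, ← Real.rpow_natCast, ← Real.rpow_mul hl.le, ← Real.rpow_mul hl.le, hθ, hη]
        congr 1
        push_cast
        ring
      rw [e2]
      have : ((lam n ^ 2) ^ 2) ^ η ≠ 0 := by positivity
      have : (A ^ 2) ^ θ ≠ 0 := by positivity
      have : (B ^ 2) ^ η ≠ 0 := by positivity
      field_simp
      exact e1
    rw [hprod, div_le_iff₀ (by positivity)] at am
    refine am.trans (le_of_eq ?_)
    rw [div_pow]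
    ring
  · rw [tsum_mul_left, (h1.mul_left _).tsum_add (h2.mul_left _), tsum_mul_left, tsum_mul_left]
    have i1 : θ / A ^ 2 * ∑' n, lam n ^ (2 * p) * inner ℝ x (φ n) ^ 2 ≤ θ := by
      refine (mul_le_mul_of_nonneg_left h1' (by positivity)).trans (le_of_eq ?_)
      field_simp
    have i2 : η / B ^ 2 * ∑' n, (inner ℝ x (φ n) / lam n ^ 2) ^ 2 ≤ η := by
      refine (mul_le_mul_of_nonneg_left h2' (by positivity)).trans (le_of_eq ?_)
      field_simp
    exact mul_le_of_le_one_right (by positivity) (by linarith)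

/-- The discrepancy `‖v α - k‖` of the filtered element `v α` takes each value between `0` and
`‖k‖` exactly once. -/
theorem existsUnique_discrepancy {L : ℕ → ℝ} (hL0 : 0 < L 0) (hL : ∀ n, L 0 ≤ L n) {v : ℝ → E}
    {k : E} (hv : ∀ α, 0 ≤ α → ∀ n, inner ℝ (v α) (φ n) = inner ℝ k (φ n) / (1 + α * L n))
    {η : ℝ} (hη : 0 < η) (hηk : η < ‖k‖) : ∃! α, 0 < α ∧ ‖v α - k‖ = η := by
  have hLpos : ∀ n, 0 < L n := fun n => hL0.trans_le (hL n)
  have hcoef : ∀ α, 0 ≤ α → ∀ n,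
      inner ℝ (v α - k) (φ n) = -(α * L n / (1 + α * L n)) * inner ℝ k (φ n) := by
    intro α hα n
    have := hLpos n
    have : 0 < 1 + α * L n := by positivity
    rw [inner_sub_left, hv α hα]
    field_simp
    ring
  have hmono : StrictMonoOn (fun α => ‖v α - k‖) (Ici 0) := by
    intro α hα β hβ hαβ
    have hα : 0 ≤ α := hα
    have hβ : 0 ≤ β := hβ
    refine lt_of_pow_lt_pow_left₀ 2 (norm_nonneg _) ?_
    have hlt : ∀ n, (α * L n / (1 + α * L n)) ^ 2 < (β * L n / (1 + β * L n)) ^ 2 := by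
      intro n
      have hn := hLpos n
      refine pow_lt_pow_left₀ ?_ (by positivity) two_ne_zero
      rw [div_lt_div_iff₀ (by positivity) (by positivity)]
      nlinarith [mul_lt_mul_of_pos_right hαβ hn]
    -- Strictness needs one nonzero coefficient of `k`, which exists since `0 < η < ‖k‖`.
    obtain ⟨i, hi⟩ : ∃ i, inner ℝ k (φ i) ≠ 0 := by
      by_contra! h0
      have : k = 0 := ext_inner φ fun n => by simp [h0 n]
      rw [this, norm_zero] at hηk
      linarith
    refine hasSum_lt (i := i) (fun n => ?_) ?_ (hasSum_inner_sq φ (v α - k))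
      (hasSum_inner_sq φ (v β - k))
    · simp only [hcoef α hα, hcoef β hβ, mul_pow, neg_sq]
      exact mul_le_mul_of_nonneg_right (hlt n).le (sq_nonneg _)
    · simp only [hcoef α hα, hcoef β hβ, mul_pow, neg_sq]
      exact mul_lt_mul_of_pos_right (hlt i) (by positivity)
  have hcont : ContinuousOn v (Ici 0) := by
    refine continuousOn_of_inner φ (B := fun n => |inner ℝ k (φ n)|)
      (by simpa using (hasSum_inner_sq φ k).summable) (fun n => ?_) fun α hα n => ?_
    · have : ContinuousOn (fun α => inner ℝ k (φ n) / (1 + α * L n)) (Ici 0) := by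
        refine ContinuousOn.div (by fun_prop) (by fun_prop) fun α hα => ?_
        have := mul_nonneg hα (hLpos n).le
        positivity
      exact this.congr fun α hα => hv α hα n
    · have : 0 ≤ α * L n := mul_nonneg hα (hLpos n).le
      rw [hv α hα, abs_div, abs_of_pos (by positivity : 0 < 1 + α * L n)]
      exact div_le_self (abs_nonneg _) (by linarith)
  have hzero : ‖v 0 - k‖ = 0 := by
    rw [norm_eq_zero, sub_eq_zero]
    exact ext_inner φ fun n => by simp [hv 0 le_rfl]
  -- Chosen so that `‖k‖ / (1 + β L 0) = ‖k‖ - η`; the left side bounds `‖v β‖`, whence `‖v β - k‖ ≥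
  -- η`.
  set β := η / ((‖k‖ - η) * L 0) with hβ
  have hkη : 0 < ‖k‖ - η := sub_pos.2 hηk
  have hβ0 : 0 ≤ β := by positivity
  have hlarge : η ≤ ‖v β - k‖ := by
    have h1 : ‖v β‖ ≤ 1 / (1 + β * L 0) * ‖k‖ := by
      refine norm_le_mul_of_abs_inner_le φ (by positivity) fun n => ?_
      have hn := hL n
      have hn' := hLpos n
      rw [hv β hβ0, abs_div, abs_of_pos (by positivity : 0 < 1 + β * L n), div_eq_mul_one_div,
        mul_comm]
      gcongr
    have h2 : 1 / (1 + β * L 0) * ‖k‖ = ‖k‖ - η := by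
      have hk : 0 < ‖k‖ := hη.trans hηk
      have : β * L 0 = η / (‖k‖ - η) := by rw [hβ]; field_simp
      rw [this]
      field_simp
      ring
    have h3 := norm_sub_norm_le k (v β)
    rw [norm_sub_rev] at h3
    linarith
  obtain ⟨α, hα, hαη⟩ := intermediate_value_Icc hβ0
    (f := fun α => ‖v α - k‖)
    ((hcont.sub continuousOn_const).norm.mono Icc_subset_Ici_self)
    (show η ∈ Icc _ _ from ⟨hzero.trans_le hη.le, hlarge⟩)
  refine ⟨α, ⟨lt_of_le_of_ne hα.1 fun h => ?_, hαη⟩, fun γ hγ => ?_⟩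
  · simp only [← h, hzero] at hαη
    linarith
  · exact hmono.injOn hγ.1.le hα.1 (hγ.2.trans hαη.symm)

end HilbertBasis

/-! ### Filter bounds and the two parts of the error -/

section Regularization

variable {d : ℕ} {Ω : Set (EuclideanSpace ℝ (Fin d))} {lam : ℕ → ℝ}
  {φ : HilbertBasis ℕ ℝ (L2 Ω ℝ)}

theorem inner_opB (hlam : ∀ n, 0 < lam n) (b : ℝ) {α : ℝ} (hα : 0 ≤ α) (k : L2 Ω ℝ) (n : ℕ) :
    inner ℝ (opB lam φ b α k) (φ n) = inner ℝ k (φ n) / (1 + α * lam n ^ b) := by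
  obtain ⟨x, hx⟩ := exists_hasSum_of_summable_sq φ
    (c := fun n => inner ℝ k (φ n) / (1 + α * lam n ^ b)) (by
      refine (hasSum_inner_sq φ k).summable.of_nonneg_of_le (fun n => sq_nonneg _) fun n => ?_
      have := Real.rpow_pos_of_pos (hlam n) b
      rw [div_pow]
      refine div_le_self (sq_nonneg _) (one_le_pow₀ ?_)
      have : 0 ≤ α * lam n ^ b := by positivity
      linarith)
  rw [opB, hx.tsum_eq]
  exact inner_of_hasSum φ hx n

theorem inner_opB_sub (hlam : ∀ n, 0 < lam n) (b : ℝ) {α : ℝ} (hα : 0 ≤ α) (k : L2 Ω ℝ) (n : ℕ) :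
    inner ℝ (opB lam φ b α k - k) (φ n) =
      -(α * lam n ^ b / (1 + α * lam n ^ b) * inner ℝ k (φ n)) := by
  have := Real.rpow_pos_of_pos (hlam n) b
  have : 0 < 1 + α * lam n ^ b := by positivity
  rw [inner_sub_left, inner_opB hlam b hα]
  field_simp
  ring

theorem div_one_add_nonneg_le_one {x : ℝ} (hx : 0 ≤ x) : 0 ≤ x / (1 + x) ∧ x / (1 + x) ≤ 1 :=
  ⟨by positivity, (div_le_one (by linarith)).2 (by linarith)⟩

theorem norm_opB_sub_sub_le (hlam : ∀ n, 0 < lam n) (b : ℝ) {α : ℝ} (hα : 0 ≤ α) (h k : L2 Ω ℝ) :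
    ‖(opB lam φ b α h - h) - (opB lam φ b α k - k)‖ ≤ ‖h - k‖ := by
  rw [← one_mul ‖h - k‖]
  refine norm_le_mul_of_abs_inner_le φ zero_le_one fun n => ?_
  have := Real.rpow_pos_of_pos (hlam n) b
  have h1 := div_one_add_nonneg_le_one (show 0 ≤ α * lam n ^ b by positivity)
  rw [inner_sub_left, inner_opB_sub hlam b hα, inner_opB_sub hlam b hα, neg_sub_neg, ← mul_sub,
    inner_sub_left, abs_mul, abs_sub_comm, abs_of_nonneg h1.1]
  exact mul_le_mul_of_nonneg_right h1.2 (abs_nonneg _)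

theorem rpow_two_le_one_add_rpow {y b : ℝ} (hy : 0 ≤ y) (hb : 2 ≤ b) : y ^ (2 / b) ≤ 1 + y := by
  have hb' : 2 / b ≤ 1 := (div_le_one (by linarith)).2 hb
  rcases le_total y 1 with h | h
  · have := Real.rpow_le_one hy h (by positivity : 0 ≤ 2 / b)
    linarith
  · have := Real.rpow_le_rpow_of_exponent_le h hb'
    rw [Real.rpow_one] at this
    linarith

/-- Substituting `y = α l^b` turns `l²` into `α^(-2/b) y^(2/b)`, and `y^(2/b) ≤ 1 + y` since `2/b ≤
1`. -/
theorem sq_div_one_add_le {l b α : ℝ} (hl : 0 < l) (hα : 0 < α) (hb : 2 ≤ b) :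
    l ^ 2 / (1 + α * l ^ b) ≤ α ^ (-(2 / b)) := by
  have hlb := Real.rpow_pos_of_pos hl b
  rw [div_le_iff₀ (by positivity)]
  have h1 := rpow_two_le_one_add_rpow (show 0 ≤ α * l ^ b by positivity) hb
  rw [Real.mul_rpow hα.le hlb.le, ← Real.rpow_mul hl.le, mul_div_cancel₀ _ (by linarith : b ≠ 0),
    Real.rpow_two] at h1
  have h2 : α ^ (-(2 / b)) * α ^ (2 / b) = 1 := by rw [← Real.rpow_add hα]; simp
  have := mul_le_mul_of_nonneg_left h1 (Real.rpow_pos_of_pos hα (-(2 / b))).le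
  rwa [← mul_assoc, h2, one_mul] at this

/-- With `x = α l^b`, this is `x / (1 + x) ≤ min x 1 ≤ x^r` for `r = (q + 2)/b`; the condition `r ≤
1` is the saturation of the filter. -/
theorem div_one_add_le_rpow {l b q α : ℝ} (hl : 0 < l) (hα : 0 < α) (hq : 0 ≤ q) (hqb : q + 2 ≤ b) :
    α * l ^ b / (1 + α * l ^ b) ≤ α ^ ((q + 2) / b) * (l ^ q * l ^ 2) := by
  have hlb := Real.rpow_pos_of_pos hl b
  have hb : 0 < b := by linarith
  set x := α * l ^ b with hx
  have hx0 : 0 < x := by positivity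
  have e : α ^ ((q + 2) / b) * (l ^ q * l ^ 2) = x ^ ((q + 2) / b) := by
    rw [hx, Real.mul_rpow hα.le hlb.le, ← Real.rpow_mul hl.le, mul_div_cancel₀ _ hb.ne',
      Real.rpow_add hl, Real.rpow_two]
  rw [e]
  have h1 : (q + 2) / b ≤ 1 := (div_le_one hb).2 hqb
  rcases le_total x 1 with h | h
  · have := Real.rpow_le_rpow_of_exponent_ge hx0 h h1
    rw [Real.rpow_one] at this
    exact (div_le_self hx0.le (by linarith)).trans this
  · exact (div_one_add_nonneg_le_one hx0.le).2.trans
      (Real.one_le_rpow h (by positivity))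

/-- Excess smoothness is traded for a power of the smallest eigenvalue; this is how `lam 0` enters
`C₄` and `C₅`. -/
theorem sourceSet_mono (hlam0 : 0 < lam 0) (hmono : Monotone lam) {ϱ p q : ℝ}
    (hqp : q ≤ p) {f : L2 Ω ℝ} (hf : f ∈ sourceSet lam φ ϱ p) :
    f ∈ sourceSet lam φ (ϱ * lam 0 ^ (q - p)) q := by
  have hle : ∀ n, lam n ^ (2 * q) * |inner ℝ f (φ n)| ^ 2 ≤
      (lam 0 ^ (q - p)) ^ 2 * (lam n ^ (2 * p) * |inner ℝ f (φ n)| ^ 2) := by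
    intro n
    have hn := hmono (Nat.zero_le n)
    have hl := hlam0.trans_le hn
    rw [← mul_assoc]
    gcongr
    have h1 : lam n ^ (q - p) ≤ lam 0 ^ (q - p) :=
      Real.rpow_le_rpow_of_nonpos hlam0 hn (by linarith)
    calc lam n ^ (2 * q) = (lam n ^ (q - p)) ^ 2 * lam n ^ (2 * p) := by
          rw [← Real.rpow_natCast, ← Real.rpow_mul hl.le, ← Real.rpow_add hl]
          congr 1
          push_cast
          ring
      _ ≤ _ := by gcongr
  have hs := hf.1.mul_left ((lam 0 ^ (q - p)) ^ 2)
  have hn0 : ∀ n, 0 ≤ lam n ^ (2 * q) * |inner ℝ f (φ n)| ^ 2 := fun n =>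
    mul_nonneg (Real.rpow_nonneg (hlam0.trans_le (hmono (Nat.zero_le n))).le _) (sq_nonneg _)
  have hs' := hs.of_nonneg_of_le hn0 hle
  refine ⟨hs', (hs'.tsum_le_tsum hle hs).trans ?_⟩
  rw [tsum_mul_left, mul_pow, mul_comm (ϱ ^ 2)]
  exact mul_le_mul_of_nonneg_left hf.2 (sq_nonneg _)

/-- The approximation error of the regularization with exact data. -/
theorem norm_sub_opB_le (hlam : ∀ n, 0 < lam n) {b p ϱ α C D : ℝ} (hp : 0 < p) (hϱ : 0 < ϱ)
    (hα : 0 < α) (hC : 0 < C) (hD : 0 < D) {m : ℕ → ℝ} (hm : ∀ n, C / lam n ^ 2 ≤ |m n|)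
    {f h : L2 Ω ℝ} (hf : f ∈ sourceSet lam φ ϱ p)
    (hh : ∀ n, inner ℝ h (φ n) = m n * inner ℝ f (φ n)) (hres : ‖opB lam φ b α h - h‖ ≤ D) :
    ‖f - opB lam φ b α f‖ ≤ ϱ ^ (2 / (p + 2)) * (D / C) ^ (p / (p + 2)) := by
  rw [norm_sub_rev]
  set e := opB lam φ b α f - f with he
  have h1 : ∀ n, inner ℝ e (φ n) ^ 2 ≤ |inner ℝ f (φ n)| ^ 2 := by
    intro n
    have := Real.rpow_pos_of_pos (hlam n) b
    have h2 := div_one_add_nonneg_le_one (show 0 ≤ α * lam n ^ b by positivity)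
    rw [inner_opB_sub hlam b hα.le, neg_sq, mul_pow, sq_abs]
    exact mul_le_of_le_one_left (sq_nonneg _) (pow_le_one₀ h2.1 h2.2)
  have h1' : ∀ n, lam n ^ (2 * p) * inner ℝ e (φ n) ^ 2 ≤
      lam n ^ (2 * p) * |inner ℝ f (φ n)| ^ 2 := fun n =>
    mul_le_mul_of_nonneg_left (h1 n) (Real.rpow_nonneg (hlam n).le _)
  have hs1 := hf.1.of_nonneg_of_le
    (fun n => mul_nonneg (Real.rpow_nonneg (hlam n).le _) (sq_nonneg _)) h1'
  have hr := (hasSum_inner_sq φ (opB lam φ b α h - h)).mul_left ((1 / C) ^ 2)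
  -- The residual of `h` has coefficients `m n` times those of `e`, and `1 / lam n ^ 2 ≤ |m n| / C`.
  have h2 : ∀ n, (inner ℝ e (φ n) / lam n ^ 2) ^ 2 ≤
      (1 / C) ^ 2 * inner ℝ (opB lam φ b α h - h) (φ n) ^ 2 := by
    intro n
    have hl := hlam n
    have h3 : inner ℝ (opB lam φ b α h - h) (φ n) = m n * inner ℝ e (φ n) := by
      rw [inner_opB_sub hlam b hα.le, inner_opB_sub hlam b hα.le, hh]
      ring
    have h4 : (1 / lam n ^ 2) ^ 2 ≤ (1 / C) ^ 2 * m n ^ 2 := by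
      rw [← sq_abs (m n), ← mul_pow]
      gcongr
      have := mul_le_mul_of_nonneg_left (hm n) (by positivity : 0 ≤ 1 / C)
      refine le_trans (le_of_eq ?_) this
      field_simp
    rw [h3, mul_pow, ← mul_assoc, div_eq_mul_one_div, mul_pow, mul_comm]
    gcongr
  have hs2 := hr.summable.of_nonneg_of_le (fun n => sq_nonneg _) h2
  refine norm_le_of_interpolation φ hlam hp hϱ (by positivity) hs1
    ((hs1.tsum_le_tsum h1' hf.1).trans hf.2) hs2
    ((hs2.tsum_le_tsum h2 hr.summable).trans ?_)
  rw [hr.tsum_eq, ← mul_pow]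
  gcongr
  rw [one_div_mul_eq_div]
  gcongr

/-- The propagated data error of the regularization. -/
theorem norm_opB_sub_le (hlam : ∀ n, 0 < lam n) {b α C : ℝ} (hb : 2 ≤ b)
    (hα : 0 < α) (hC : 0 < C) {m : ℕ → ℝ} (hm : ∀ n, C / lam n ^ 2 ≤ |m n|) {f g h k : L2 Ω ℝ}
    (hh : ∀ n, inner ℝ h (φ n) = m n * inner ℝ f (φ n))
    (hg : ∀ n, (1 + α * lam n ^ b) * m n * inner ℝ g (φ n) = inner ℝ k (φ n)) :
    ‖opB lam φ b α f - g‖ ≤ α ^ (-(2 / b)) / C * ‖h - k‖ := by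
  refine norm_le_mul_of_abs_inner_le φ (by positivity) fun n => ?_
  have hl := hlam n
  have hlb := Real.rpow_pos_of_pos hl b
  have hpos : 0 < 1 + α * lam n ^ b := by positivity
  have hkey : inner ℝ h (φ n) - inner ℝ k (φ n) =
      (1 + α * lam n ^ b) * m n * inner ℝ (opB lam φ b α f - g) (φ n) := by
    rw [hh, ← hg, inner_sub_left, inner_opB hlam b hα.le]
    field_simp
  set z := inner ℝ (opB lam φ b α f - g) (φ n)
  rw [inner_sub_left, hkey, abs_mul, abs_mul, abs_of_pos hpos]
  have h1 := sq_div_one_add_le hl hα hb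
  rw [div_le_iff₀ hpos] at h1
  have h2 : lam n ^ 2 ≤ α ^ (-(2 / b)) / C * ((1 + α * lam n ^ b) * |m n|) * lam n ^ 2 := by
    have h3 : 1 ≤ |m n| / C * lam n ^ 2 := by
      have := hm n
      rw [div_le_iff₀ (by positivity)] at this
      rw [div_mul_eq_mul_div, one_le_div hC]
      exact this
    calc lam n ^ 2 ≤ α ^ (-(2 / b)) * (1 + α * lam n ^ b) * 1 := by rwa [mul_one]
      _ ≤ α ^ (-(2 / b)) * (1 + α * lam n ^ b) * (|m n| / C * lam n ^ 2) := by gcongr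
      _ = _ := by ring
  have h4 : 1 ≤ α ^ (-(2 / b)) / C * ((1 + α * lam n ^ b) * |m n|) :=
    le_of_mul_le_mul_right (by rwa [one_mul]) (by positivity : 0 < lam n ^ 2)
  rw [← mul_assoc]
  exact le_mul_of_one_le_left (abs_nonneg z) h4

/-- The residual of exact data under a source condition. -/
theorem norm_opB_sub_self_le (hlam : ∀ n, 0 < lam n) {b q M N α : ℝ} (hq : 0 ≤ q)
    (hqb : q + 2 ≤ b) (hM : 0 ≤ M) (hN : 0 ≤ N) (hα : 0 < α) {m : ℕ → ℝ}
    (hm : ∀ n, |m n| ≤ N / lam n ^ 2) {f h : L2 Ω ℝ} (hf : f ∈ sourceSet lam φ M q)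
    (hh : ∀ n, inner ℝ h (φ n) = m n * inner ℝ f (φ n)) :
    ‖opB lam φ b α h - h‖ ≤ N * M * α ^ ((q + 2) / b) := by
  have hs := hf.1.mul_left ((N * α ^ ((q + 2) / b)) ^ 2)
  refine norm_le_of_inner_sq_le φ (by positivity) hs (fun n => ?_) ?_
  · have hl := hlam n
    have hlb := Real.rpow_pos_of_pos hl b
    have h1 := div_one_add_le_rpow hl hα hq hqb
    have h0 := (div_one_add_nonneg_le_one (show 0 ≤ α * lam n ^ b by positivity)).1
    rw [inner_opB_sub hlam b hα.le, hh, neg_sq]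
    have e : lam n ^ (2 * q) = (lam n ^ q) ^ 2 := by
      rw [← Real.rpow_natCast, ← Real.rpow_mul hl.le, mul_comm]
      norm_num
    rw [e, ← mul_pow, ← mul_pow, ← sq_abs]
    refine pow_le_pow_left₀ (abs_nonneg _) ?_ 2
    rw [abs_mul, abs_mul, abs_of_nonneg h0, ← mul_assoc, ← mul_assoc]
    refine mul_le_mul_of_nonneg_right ?_ (abs_nonneg _)
    refine (mul_le_mul h1 (hm n) (abs_nonneg _) (by positivity)).trans (le_of_eq ?_)
    field_simp
  · rw [tsum_mul_left]
    refine (mul_le_mul_of_nonneg_left hf.2 (sq_nonneg _)).trans (le_of_eq ?_)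
    ring

theorem rpow_neg_two_div_le {α c M r b : ℝ} (hα : 0 < α) (hc : 0 < c) (hr : 0 < r)
    (h : c ≤ M * α ^ (r / b)) : α ^ (-(2 / b)) ≤ (M / c) ^ (2 / r) := by
  have h1 : α ^ (-(r / b)) ≤ M / c := by
    rw [Real.rpow_neg hα.le, le_div_iff₀ hc, inv_mul_le_iff₀ (by positivity)]
    linarith
  have h2 := Real.rpow_le_rpow (by positivity) h1 (by positivity : 0 ≤ 2 / r)
  rw [← Real.rpow_mul hα.le] at h2
  convert h2 using 2
  field_simp

/-- The condition at the single time `τ` suffices because `|μ_n(t)| ≤ (N / C) |μ_n(τ)|`: the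
coefficients of `v t` are dominated by `N / C` times those of `k`, uniformly in `t`, which gives
both existence and continuity of `v`. Membership of `g` in `ℍ_{b-2}` follows from `α λ_n^b C / λ_n²
≤ (1 + α λ_n^b) |μ_n(τ)|`. -/
theorem isQRSource_iff (hlam0 : 0 < lam 0) (hmono : Monotone lam) {τ : ℝ} (hτ : 0 < τ)
    {ψ : ℝ → ℝ} (hψ : ContinuousOn ψ (Icc 0 τ)) {C b α : ℝ} (hC : IsLowerConst lam τ ψ C)
    (hα : 0 < α) {k g : L2 Ω ℝ} :
    IsQRSource lam φ τ ψ b α k g ↔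
      ∀ n, (1 + α * lam n ^ b) * mu ψ (lam n) τ * inner ℝ g (φ n) = inner ℝ k (φ n) := by
  have hlam : ∀ n, 0 < lam n := fun n => hlam0.trans_le (hmono (Nat.zero_le n))
  obtain ⟨hC0, hCn⟩ := hC
  have hτmem : τ ∈ Icc 0 τ := ⟨hτ.le, le_rfl⟩
  refine ⟨?_, fun hg => ?_⟩
  · rintro ⟨v, ⟨-, -, hv⟩, rfl⟩ n
    exact (inner_of_hasSum φ (hv τ hτmem) n).symm
  set N := supNorm τ ψ
  have hN : 0 ≤ N := (abs_nonneg _).trans (abs_le_supNorm hψ hτmem)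
  have hbound : ∀ t ∈ Icc 0 τ, ∀ n,
      |(1 + α * lam n ^ b) * mu ψ (lam n) t * inner ℝ g (φ n)| ≤ N / C * |inner ℝ k (φ n)| := by
    intro t ht n
    have hl := hlam n
    have hlb := Real.rpow_pos_of_pos hl b
    have hpos : 0 < 1 + α * lam n ^ b := by positivity
    have h1 : |mu ψ (lam n) t| ≤ N / C * |mu ψ (lam n) τ| := by
      refine (abs_mu_le hψ hl ht).trans ?_
      refine le_trans (le_of_eq ?_) (mul_le_mul_of_nonneg_left (hCn n) (by positivity : 0 ≤ N / C))
      field_simp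
      rfl
    rw [← hg n]
    simp only [abs_mul, abs_of_pos hpos]
    calc (1 + α * lam n ^ b) * |mu ψ (lam n) t| * |inner ℝ g (φ n)|
        ≤ (1 + α * lam n ^ b) * (N / C * |mu ψ (lam n) τ|) * |inner ℝ g (φ n)| := by gcongr
      _ = _ := by ring
  have hBs : Summable fun n => (N / C * |inner ℝ k (φ n)|) ^ 2 := by
    simpa only [mul_pow, sq_abs] using (hasSum_inner_sq φ k).summable.mul_left ((N / C) ^ 2)
  have hex : ∀ t, ∃ x : L2 Ω ℝ, t ∈ Icc 0 τ →
      HasSum (fun n => ((1 + α * lam n ^ b) * mu ψ (lam n) t * inner ℝ g (φ n)) • φ n) x := by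
    intro t
    by_cases ht : t ∈ Icc 0 τ
    · obtain ⟨x, hx⟩ := exists_hasSum_of_summable_sq φ (hBs.of_nonneg_of_le
        (fun n => sq_nonneg ((1 + α * lam n ^ b) * mu ψ (lam n) t * inner ℝ g (φ n))) fun n => by
          rw [← sq_abs]
          exact pow_le_pow_left₀ (abs_nonneg _) (hbound t ht n) 2)
      exact ⟨x, fun _ => hx⟩
    · exact ⟨0, fun h => absurd h ht⟩
  choose v hv using hex
  refine ⟨v, ⟨?_, ?_, hv⟩, ext_inner φ fun n => ?_⟩
  · refine ((hasSum_inner_sq φ k).summable.mul_left ((1 / (C * α)) ^ 2)).of_nonneg_of_le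
      (fun n => mul_nonneg (Real.rpow_nonneg (hlam n).le _) (sq_nonneg _)) fun n => ?_
    have hl := hlam n
    have hlb := Real.rpow_pos_of_pos hl b
    have e : lam n ^ (2 * (b - 2)) = (lam n ^ b / lam n ^ 2) ^ 2 := by
      rw [← Real.rpow_two (lam n), ← Real.rpow_sub hl, ← Real.rpow_natCast, ← Real.rpow_mul hl.le,
        mul_comm]
      norm_num
    rw [e, ← mul_pow, ← sq_abs (inner ℝ k (φ n)), ← mul_pow, ← hg n, abs_mul, abs_mul,
      abs_of_pos (by positivity : 0 < 1 + α * lam n ^ b), ← mul_assoc]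
    gcongr
    calc lam n ^ b / lam n ^ 2 = 1 / (C * α) * (α * lam n ^ b * (C / lam n ^ 2)) := by field_simp
      _ ≤ 1 / (C * α) * ((1 + α * lam n ^ b) * |mu ψ (lam n) τ|) := by
        gcongr
        · linarith
        · exact hCn n
  · refine continuousOn_of_inner φ hBs (fun n => ?_) fun t ht n => ?_
    · exact ((continuousOn_const.mul (continuousOn_mu hτ.le hψ)).mul continuousOn_const).congr
        fun t ht => inner_of_hasSum φ (hv t ht) n
    · rw [inner_of_hasSum φ (hv t ht) n]
      exact hbound t ht n
  · rw [inner_of_hasSum φ (hv τ hτmem) n, hg n]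

theorem existsUnique_isQRSource (hlam0 : 0 < lam 0) (hmono : Monotone lam) {τ : ℝ} (hτ : 0 < τ)
    {ψ : ℝ → ℝ} (hψ : ContinuousOn ψ (Icc 0 τ)) {C b α : ℝ} (hC : IsLowerConst lam τ ψ C)
    (hb : 2 ≤ b) (hα : 0 < α) (k : L2 Ω ℝ) : ∃! g, IsQRSource lam φ τ ψ b α k g := by
  simp only [isQRSource_iff hlam0 hmono hτ hψ hC hα]
  have hlam : ∀ n, 0 < lam n := fun n => hlam0.trans_le (hmono (Nat.zero_le n))
  have hfac : ∀ n, (1 + α * lam n ^ b) * mu ψ (lam n) τ ≠ 0 := fun n => by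
    have hlb := Real.rpow_pos_of_pos (hlam n) b
    have := (div_pos hC.1 (pow_pos (hlam n) 2)).trans_le (hC.2 n)
    exact mul_ne_zero (by positivity) (abs_pos.1 this)
  obtain ⟨g, hg⟩ := exists_hasSum_of_summable_sq φ
    (c := fun n => inner ℝ k (φ n) / ((1 + α * lam n ^ b) * mu ψ (lam n) τ)) (by
      refine ((hasSum_inner_sq φ k).summable.mul_left ((α ^ (-(2 / b)) / C) ^ 2)).of_nonneg_of_le
        (fun n => sq_nonneg _) fun n => ?_
      have hl := hlam n
      have hlb := Real.rpow_pos_of_pos hl b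
      have hpos : 0 < 1 + α * lam n ^ b := by positivity
      have hCl : 0 < C / lam n ^ 2 := div_pos hC.1 (by positivity)
      have h2 : 1 / ((1 + α * lam n ^ b) * |mu ψ (lam n) τ|) ≤ α ^ (-(2 / b)) / C := by
        calc 1 / ((1 + α * lam n ^ b) * |mu ψ (lam n) τ|)
            ≤ 1 / ((1 + α * lam n ^ b) * (C / lam n ^ 2)) := by
              gcongr
              exact hC.2 n
          _ = lam n ^ 2 / (1 + α * lam n ^ b) / C := by
              have := hC.1
              field_simp
          _ ≤ _ := div_le_div_of_nonneg_right (sq_div_one_add_le hl hα hb) hC.1.le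
      have := (div_pos hC.1 (pow_pos hl 2)).trans_le (hC.2 n)
      rw [div_eq_mul_one_div, mul_pow, mul_comm, ← sq_abs (1 / _), abs_div, abs_one, abs_mul,
        abs_of_pos hpos]
      gcongr)
  refine ⟨g, fun n => ?_, fun g' hg' => ext_inner φ fun n => ?_⟩
  · rw [inner_of_hasSum φ hg n, mul_div_cancel₀ _ (hfac n)]
  · rw [inner_of_hasSum φ hg n, eq_div_iff (hfac n), ← hg' n, mul_comm]

end Regularization

/-! ### Combined error estimate and the theorem -/

/-- The error estimate for the discrepancy principle with level `ξ * D`, where `D` is at least the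
noise level `δ`. -/
theorem norm_sub_le_of_discrepancy {d : ℕ} {Ω : Set (EuclideanSpace ℝ (Fin d))} {lam : ℕ → ℝ}
    {φ : HilbertBasis ℕ ℝ (L2 Ω ℝ)} (hlam : ∀ n, 0 < lam n) {b p q ϱ M N α C D δ ξ : ℝ}
    (hp : 0 < p) (hϱ : 0 < ϱ) (hq : 0 ≤ q) (hqb : q + 2 ≤ b) (hM : 0 ≤ M) (hN : 0 ≤ N)
    (hα : 0 < α) (hC : 0 < C) (hD : 0 < D) (hξ : 1 < ξ) (hδD : δ ≤ D) {m : ℕ → ℝ}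
    (hm : ∀ n, C / lam n ^ 2 ≤ |m n|) (hm' : ∀ n, |m n| ≤ N / lam n ^ 2) {f g h k : L2 Ω ℝ}
    (hf : f ∈ sourceSet lam φ ϱ p) (hfq : f ∈ sourceSet lam φ M q)
    (hh : ∀ n, inner ℝ h (φ n) = m n * inner ℝ f (φ n))
    (hg : ∀ n, (1 + α * lam n ^ b) * m n * inner ℝ g (φ n) = inner ℝ k (φ n))
    (hhk : ‖h - k‖ ≤ δ) (hres : ‖opB lam φ b α k - k‖ = ξ * D) :
    ‖f - g‖ ≤ ((ξ + 1) / C) ^ (p / (p + 2)) * ϱ ^ (2 / (p + 2)) * D ^ (p / (p + 2)) +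
      1 / C * (N * M / ((ξ - 1) * D)) ^ (2 / (q + 2)) * δ := by
  have hdiff := (norm_opB_sub_sub_le (φ := φ) hlam b hα.le h k).trans hhk
  set rh := opB lam φ b α h - h
  set rk := opB lam φ b α k - k
  -- Exact and noisy residuals differ by at most `δ ≤ D`, so the exact one lies between `(ξ - 1) D`
  -- and `(ξ + 1) D`.
  have hup : ‖rh‖ ≤ (ξ + 1) * D := by
    have := norm_le_norm_add_norm_sub rk rh
    rw [norm_sub_rev rk rh] at this
    linarith
  have hlow : (ξ - 1) * D ≤ ‖rh‖ := by
    have := norm_le_norm_add_norm_sub rh rk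
    linarith
  have h1 := norm_sub_opB_le hlam hp hϱ hα hC (by positivity) hm hf hh hup
  have h2 := norm_opB_sub_le hlam (b := b) (by linarith) hα hC hm hh hg
  have h3 := rpow_neg_two_div_le hα (mul_pos (sub_pos.2 hξ) hD) (by linarith : 0 < q + 2)
    (hlow.trans (norm_opB_sub_self_le hlam hq hqb hM hN hα hm' hfq hh))
  have h4 : α ^ (-(2 / b)) / C * ‖h - k‖ ≤
      1 / C * (N * M / ((ξ - 1) * D)) ^ (2 / (q + 2)) * δ := by
    rw [div_eq_mul_one_div, mul_comm (α ^ _)]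
    gcongr
  have h5 : ((ξ + 1) * D / C) ^ (p / (p + 2)) =
      ((ξ + 1) / C) ^ (p / (p + 2)) * D ^ (p / (p + 2)) := by
    rw [← Real.mul_rpow (by positivity) hD.le]
    congr 1
    ring
  have h6 := norm_sub_le_norm_sub_add_norm_sub f (opB lam φ b α f) g
  rw [h5] at h1
  linarith

theorem mul_rpow_two_div_mul {X ϱ δ r : ℝ} (hX : 0 ≤ X) (hϱ : 0 ≤ ϱ) (hδ : 0 < δ) (hr : r ≠ 0) :
    (X * ϱ / δ) ^ (2 / r) * δ = X ^ (2 / r) * ϱ ^ (2 / r) * δ ^ ((r - 2) / r) := by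
  rw [Real.div_rpow (by positivity) hδ.le, Real.mul_rpow hX hϱ, sub_div, div_self hr,
    Real.rpow_sub hδ, Real.rpow_one]
  ring

end BiParabolic

theorem theorem4p3 :
    -- the constants, as functions of the quantities they may depend on
    ∃ (Capost : (C ξ p : ℝ) → ℝ) (C₆ : (C normψ ξ p : ℝ) → ℝ)
      (C₄ : (C normψ ξ lam₁ p b : ℝ) → ℝ) (C₅ : (C normψ ξ lam₁ p : ℝ) → ℝ),
      (∀ C m ξ l p b : ℝ, 0 < C → 0 < m → 1 < ξ → 0 < l → 0 < p → 2 ≤ b →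
        0 < Capost C ξ p ∧ 0 < C₆ C m ξ p ∧ 0 < C₄ C m ξ l p b ∧ 0 < C₅ C m ξ l p) ∧
      ∀ (d : ℕ) (Ω : Set (EuclideanSpace ℝ (Fin d))) (lam : ℕ → ℝ)
        (φ : HilbertBasis ℕ ℝ (BiParabolic.L2 Ω ℝ)) (τ : ℝ) (ψ : ℝ → ℝ)
        (f h hδ : BiParabolic.L2 Ω ℝ) (u : ℝ → BiParabolic.L2 Ω ℝ) (b p ϱ δ ξ : ℝ),
        1 ≤ d → IsOpen Ω → Bornology.IsBounded Ω →
        BiParabolic.IsDirichletEigenbasis Ω lam φ →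
        0 < τ → ContinuousOn ψ (Icc 0 τ) → BiParabolic.PsiAssumption τ ψ →
        2 ≤ b → 0 < p → 0 < ϱ → 0 < δ → 1 < ξ →
        -- exact source, exact final value, noisy final value
        f ∈ BiParabolic.sourceSet lam φ ϱ p →
        BiParabolic.IsSolution Ω τ ψ f u → u τ = h → ‖h - hδ‖ ≤ δ →
        -- there is a lower constant `C`, and the regularized source is well defined
        (∃ C, BiParabolic.IsLowerConst lam τ ψ C) ∧
        (∀ α > 0, ∃! g, BiParabolic.IsQRSource lam φ τ ψ b α hδ g) ∧
        -- (i)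
        (b ≠ 2 → ξ * δ < ‖hδ‖ →
          (∃! α, 0 < α ∧ ‖BiParabolic.opB lam φ b α hδ - hδ‖ = ξ * δ) ∧
          ∀ C α g, BiParabolic.IsLowerConst lam τ ψ C →
            0 < α → ‖BiParabolic.opB lam φ b α hδ - hδ‖ = ξ * δ →
            BiParabolic.IsQRSource lam φ τ ψ b α hδ g →
            (p < b - 2 →
              ‖f - g‖ ≤ C₆ C (BiParabolic.supNorm τ ψ) ξ p
                * ϱ ^ (2 / (p + 2)) * δ ^ (p / (p + 2))) ∧
            (b - 2 ≤ p →
              ‖f - g‖ ≤ Capost C ξ p * ϱ ^ (2 / (p + 2)) * δ ^ (p / (p + 2))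
                + C₄ C (BiParabolic.supNorm τ ψ) ξ (lam 0) p b
                  * ϱ ^ (2 / b) * δ ^ ((b - 2) / b))) ∧
        -- (ii)
        (b = 2 → ∀ σ ∈ Ioo (0 : ℝ) 1, δ ≤ 1 → ξ * δ ^ σ < ‖hδ‖ →
          (∃! α, 0 < α ∧ ‖BiParabolic.opB lam φ b α hδ - hδ‖ = ξ * δ ^ σ) ∧
          ∀ C α g, BiParabolic.IsLowerConst lam τ ψ C →
            0 < α → ‖BiParabolic.opB lam φ b α hδ - hδ‖ = ξ * δ ^ σ →
            BiParabolic.IsQRSource lam φ τ ψ b α hδ g →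
            ‖f - g‖ ≤ Capost C ξ p * ϱ ^ (2 / (p + 2)) * δ ^ (p * σ / (p + 2))
              + C₅ C (BiParabolic.supNorm τ ψ) ξ (lam 0) p * ϱ * δ ^ (1 - σ)) := by
  open BiParabolic in
  -- `Capost` is the approximation constant. The data error is used with `q = p` in `C₆` (where both
  -- terms have the same rate), with `q = b - 2` in `C₄`, and with `q = 0` in `C₅`.
  refine ⟨fun C ξ p => ((ξ + 1) / C) ^ (p / (p + 2)),
    fun C m ξ p => ((ξ + 1) / C) ^ (p / (p + 2)) + 1 / C * (m / (ξ - 1)) ^ (2 / (p + 2)),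
    fun C m ξ l p b => 1 / C * (m * l ^ (b - 2 - p) / (ξ - 1)) ^ (2 / b),
    fun C m ξ l p => 1 / C * (m * l ^ (-p) / (ξ - 1)), ?_, ?_⟩
  · intro C m ξ l p b hC hm hξ hl hp hb
    have := sub_pos.2 hξ
    refine ⟨by positivity, by positivity, by positivity, by positivity⟩
  intro d Ω lam φ τ ψ f h hδ u b p ϱ δ ξ hd _ hΩ heig hτ hψ hψA hb hp hϱ hδ0 hξ hf hu huτ hhδ
  have hmono := heig.1
  have hlam : ∀ n, 0 < lam n := heig.pos hd hΩ
  have hξ1 : 0 < ξ - 1 := sub_pos.2 hξ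
  have hCex := exists_isLowerConst hmono (hlam 0) hψ hψA
  have hN : 0 ≤ supNorm τ ψ := (abs_nonneg _).trans (abs_le_supNorm hψ ⟨hτ.le, le_rfl⟩)
  have hh : ∀ n, inner ℝ h (φ n) = mu ψ (lam n) τ * inner ℝ f (φ n) := fun n =>
    huτ ▸ hu.inner_final hτ hψ (heig.2 n)
  have hm' : ∀ n, |mu ψ (lam n) τ| ≤ supNorm τ ψ / lam n ^ 2 := fun n =>
    abs_mu_le hψ (hlam n) ⟨hτ.le, le_rfl⟩
  have hdisc : ∀ η, 0 < η → η < ‖hδ‖ → ∃! α, 0 < α ∧ ‖opB lam φ b α hδ - hδ‖ = η := by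
    intro η hη hηk
    exact existsUnique_discrepancy φ (L := fun n => lam n ^ b) (v := fun α => opB lam φ b α hδ)
      (Real.rpow_pos_of_pos (hlam 0) b)
      (fun n => Real.rpow_le_rpow (hlam 0).le (hmono (Nat.zero_le n)) (by linarith))
      (fun α hα n => inner_opB hlam b hα hδ n) hη hηk
  refine ⟨hCex, fun α hα => ?_, fun hb2 hlt => ⟨hdisc _ (by positivity) hlt, ?_⟩,
    fun hb2 σ hσ hδ1 hlt => ⟨hdisc _ (by positivity) hlt, ?_⟩⟩
  · obtain ⟨C, hC⟩ := hCex
    exact existsUnique_isQRSource (hlam 0) hmono hτ hψ hC hb hα hδ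
  · intro C α g hC hα hres hg
    have hg' := (isQRSource_iff (hlam 0) hmono hτ hψ hC hα).1 hg
    refine ⟨fun hpb => ?_, fun hpb => ?_⟩
    · refine (norm_sub_le_of_discrepancy hlam hp hϱ hp.le (by linarith) hϱ.le hN hα hC.1 hδ0 hξ le_rfl
        hC.2 hm' hf hf hh hg' hhδ hres).trans (le_of_eq ?_)
      have e := mul_rpow_two_div_mul (X := supNorm τ ψ / (ξ - 1)) (by positivity) hϱ.le hδ0
        (by linarith : p + 2 ≠ 0)
      rw [show supNorm τ ψ / (ξ - 1) * ϱ / δ = supNorm τ ψ * ϱ / ((ξ - 1) * δ) by field_simp,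
        add_sub_cancel_right] at e
      rw [mul_assoc (1 / C), e]
      ring
    · have hfq := sourceSet_mono (hlam 0) hmono hpb hf
      have hl := Real.rpow_pos_of_pos (hlam 0) (b - 2 - p)
      refine (norm_sub_le_of_discrepancy hlam hp hϱ (by linarith) (by linarith) (by positivity) hN hα
        hC.1 hδ0 hξ le_rfl hC.2 hm' hf hfq hh hg' hhδ hres).trans (le_of_eq ?_)
      have e := mul_rpow_two_div_mul (X := supNorm τ ψ * lam 0 ^ (b - 2 - p) / (ξ - 1))
        (by positivity) hϱ.le hδ0 (by linarith : b ≠ 0)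
      rw [show supNorm τ ψ * lam 0 ^ (b - 2 - p) / (ξ - 1) * ϱ / δ =
        supNorm τ ψ * (ϱ * lam 0 ^ (b - 2 - p)) / ((ξ - 1) * δ) by field_simp] at e
      rw [mul_assoc (1 / C), sub_add_cancel, e]
      ring
  · intro C α g hC hα hres hg
    have hg' := (isQRSource_iff (hlam 0) hmono hτ hψ hC hα).1 hg
    have hfq := sourceSet_mono (hlam 0) hmono hp.le hf
    have hl := Real.rpow_pos_of_pos (hlam 0) (0 - p)
    have hδσ : δ ≤ δ ^ σ := by
      simpa using Real.rpow_le_rpow_of_exponent_ge hδ0 hδ1 hσ.2.le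
    -- With `D = δ^σ` and `q = 0` the exponent `2 / (q + 2)` is `1`, so the data error is of order
    -- `δ / δ^σ`.
    refine (norm_sub_le_of_discrepancy hlam hp hϱ le_rfl (by linarith) (by positivity) hN hα
      hC.1 (by positivity) hξ hδσ hC.2 hm' hf hfq hh hg' hhδ hres).trans (le_of_eq ?_)
    rw [← Real.rpow_mul hδ0.le, mul_div_assoc' σ, mul_comm σ, zero_add, div_self two_ne_zero,
      Real.rpow_one, zero_sub, Real.rpow_sub hδ0, Real.rpow_one]
    field_simp
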